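/- \textbf{Setting.} Metric spaces are complete and non-empty, classes of metric spaces are taken up to isometry, group actions on metric spaces are isometric, and geodesic segments are minimal. Let $\mathcal{X}$ be a class of metric spaces. In a uniquely geodesic space, $[x,y]$ denotes the geodesic segment from $x$ to $y$ and $m_t[x,y]$ ($0\le t\le 1$) the point dividing it internally at ratio $t:(1-t)$. Write $[x,y]\parallel[x',y']$ if $d(x,x')=d(y,y')=d(m_{1/2}[x,y],m_{1/2}[x',y'])$. Assume that $\mathcal{X}$ satisfies the following six assumptions. \begin{itemize} \item $(\mathrm{S}_+)$ If $(X,d)\in\mathcal{X}$ and $r\ge 1$, then $(X,rd)\in\mathcal{X}$. \item $(\mathrm{U})$ There is a non-principal ultrafilter $\mathcal{U}$ on $\mathbb{N}$ such that for all $X_n\in\mathcal{X}$ and $w_n\in X_n$ ($n\in\mathbb{N}$) the pointed metric ultraproduct $\lim_{\mathcal{U}}(X_n,w_n)$ belongs to $\mathcal{X}$ (after forgetting the base point). Here $\lim_{\mathcal{U}}(X_n,w_n)$ is the space of all sequences $(x_n)_n$, $x_n\in X_n$, with $\sup_n d(x_n,w_n)<\infty$, with the semi-metric $\lim_{\mathcal{U}}d(x_n,y_n)$,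 modulo distance $0$. \item $(\mathrm{NPC}1)$ Every $X\in\mathcal{X}$ is uniquely geodesic, and $d(x,x')=d(y,y')$ implies $d(m_t[x,y],m_t[x',y'])\le d(x,x')$ for all $0\le t\le 1$. \item $(\mathrm{NPC}2)$ In every $X\in\mathcal{X}$, $[x,y]\parallel[x',y']$ implies $[x,x']\parallel[y,y']$. \item $(\mathrm{NPC}3)$ In every $X\in\mathcal{X}$, if $[x,y]\parallel[y,z]$, then $[x,y]\cup[y,z]$ is a geodesic segment. \item $(\mathrm{TP})$ In every $X\in\mathcal{X}$, $[x,y]\parallel[x',y']$ and $[x',y']\parallel[x'',y'']$ imply $[x,y]\parallel[x'',y'']$. \end{itemize} Assume, besides, that either all members of $\mathcal{X}$ are (real or complex) Banach spaces, or all members of $\mathcal{X}$ are $\mathrm{CAT}(0)$ spaces. For a group $G$ and a subgroup $M\leqslant G$, the pair $G\geqslant M$ has \emph{relative property $(\mathrm{F}_{\mathcal{X}})$} if for every $X\in\mathcal{X}$ and every action of $G$ on $X$ there is a point of $X$ fixed by $M$; and $G$ has \emph{property $(\mathrm{F}_{\mathcal{X}})$} if $G\geqslant G$ has relative property $(\mathrm{F}_{\mathcal{X}})$.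 \textbf{The $(\mathrm{Game}^+)$ for $(M,L,\Pi)$}, where $M,L\leqslant G$ and $\Pi\leqslant\mathrm{Aut}(G)$, is the following one-player game. A position is a pair $(H_1,H_2)$ of subgroups of $G$; the initial position is $(M,L)$. In each stage the player may make a move of one of the following types. \begin{itemize} \item Type $(\mathrm{I}^+)$: pick a subset $P\subseteq G$ such that $hH_1h^{-1}\geqslant M$ and $hH_2h^{-1}\geqslant L$ for all $h\in P$, and replace $(H_1,H_2)$ by $(\langle H_1,P\rangle,\langle H_2,P\rangle)$. \item Type $(\mathrm{II}_\sigma)$, for a permutation $\sigma$ of $\{1,2\}$: pick a subset $\Lambda\subseteq\mathrm{Inn}(G)\cdot\Pi$ such that $H_{\sigma^{-1}(1)}\geqslant\phi(M)$ and $H_{\sigma^{-1}(2)}\geqslant\phi(L)$ for all $\phi\in\Lambda$, and replace $H_i$ by $\langle H_i,\bigcup_{\phi\in\Lambda}\phi(H_{\sigma(i)})\rangle$ for $i=1,2$ simultaneously. \end{itemize} The player wins if after finitely many moves $H_1=G$ or $H_2=G$. \textbf{Theorem.} Let $\mathcal{X}$ be as above, let $G$ be a finitely generated group, and let $M,L\leqslant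 G$ and $\Pi\leqslant\mathrm{Aut}(G)$. Assume that \begin{itemize} \item[(i)] $M\cup L$ generates $G$; \item[(ii)] $\Pi$ is finite; and \item[$(\mathrm{GAME}^+)$] the player has a winning strategy for the $(\mathrm{Game}^+)$ for $(M,L,\Pi)$. \end{itemize} If $G\geqslant M$ and $G\geqslant L$ have relative property $(\mathrm{F}_{\mathcal{X}})$, then $G$ has property $(\mathrm{F}_{\mathcal{X}})$. -/

import Mathlib

open Filter Topology Set

universe u v

/-! ### Classes of metric spaces -/

/-- A non-empty complete metric space, bundled.  A class of metric spaces is a `Set CMetSpace`. -/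
structure CMetSpace : Type (u + 1) where
  carrier : Type u
  [metric : MetricSpace carrier]
  [complete : CompleteSpace carrier]
  [nonempty : Nonempty carrier]

instance : CoeSort CMetSpace.{u} (Type u) := ⟨CMetSpace.carrier⟩

attribute [instance] CMetSpace.metric CMetSpace.complete CMetSpace.nonempty

/-! ### Geodesics, parallelism, non-positive curvature -/

section Geodesic

variable {X : Type u} [MetricSpace X]

/-- `γ` is a (minimal) geodesic segment from `x` to `y`, parametrized proportionally to arc length
on `[0, 1]`.  Then `γ t` divides `[x, y]` internally at ratio `t : (1 - t)`, that is,
`γ t = m_t [x, y]`. -/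
def IsGeodesic (γ : unitInterval → X) (x y : X) : Prop :=
  γ 0 = x ∧ γ 1 = y ∧ ∀ s t : unitInterval, dist (γ s) (γ t) = |(s : ℝ) - t| * dist x y

/-- The midpoint of the parameter interval `[0, 1]`. -/
noncomputable def unitHalf : unitInterval := ⟨1 / 2, by norm_num, by norm_num⟩

/-- `[x, y] ∥ [x', y']`: `d(x, x') = d(y, y') = d(m_{1/2} [x, y], m_{1/2} [x', y'])`.
(Only used in uniquely geodesic spaces, where `γ` and `γ'` below are determined by their ends.) -/
def SegParallel (x y x' y' : X) : Prop :=
  ∃ γ γ' : unitInterval → X, IsGeodesic γ x y ∧ IsGeodesic γ' x' y' ∧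
    dist x x' = dist y y' ∧ dist y y' = dist (γ unitHalf) (γ' unitHalf)

variable (X)

/-- Every pair of points is connected by a unique geodesic segment. -/
def UniquelyGeodesic : Prop :=
  ∀ x y : X, ∃! γ : unitInterval → X, IsGeodesic γ x y

/-- `(NPC1)` -/
def NPC1 : Prop :=
  UniquelyGeodesic X ∧
    ∀ (x y x' y' : X) (γ γ' : unitInterval → X), IsGeodesic γ x y → IsGeodesic γ' x' y' →
      dist x x' = dist y y' → ∀ t : unitInterval, dist (γ t) (γ' t) ≤ dist x x'

/-- `(NPC2)` -/
def NPC2 : Prop :=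
  ∀ x y x' y' : X, SegParallel x y x' y' → SegParallel x x' y y'

/-- `(NPC3)`: if `[x, y] ∥ [y, z]`, then `[x, y] ∪ [y, z]` is a geodesic segment from `x` to `z`. -/
def NPC3 : Prop :=
  ∀ x y z : X, SegParallel x y y z →
    ∀ γ₁ γ₂ : unitInterval → X, IsGeodesic γ₁ x y → IsGeodesic γ₂ y z →
      ∃ γ : unitInterval → X, IsGeodesic γ x z ∧ range γ = range γ₁ ∪ range γ₂

/-- `(TP)`: parallelism is transitive. -/
def ParallelTransitive : Prop :=
  ∀ x y x' y' x'' y'' : X,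
    SegParallel x y x' y' → SegParallel x' y' x'' y'' → SegParallel x y x'' y''

/-- `CAT(0)` spaces: geodesic spaces all of whose geodesic triangles are at least as thin as their
comparison triangles in the Euclidean plane.  (Any two sides of a triangle share a vertex, called
`p` here; for two points on the same side there is nothing to require.) -/
def IsCAT0 : Prop :=
  (∀ x y : X, ∃ γ : unitInterval → X, IsGeodesic γ x y) ∧
    ∀ (p q r : X) (γ γ' : unitInterval → X), IsGeodesic γ p q → IsGeodesic γ' p r →
      ∀ p' q' r' : EuclideanSpace ℝ (Fin 2),
        dist p' q' = dist p q → dist p' r' = dist p r → dist q' r' = dist q r →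
        ∀ s t : unitInterval,
          dist (γ s) (γ' t) ≤
            dist (AffineMap.lineMap p' q' (s : ℝ)) (AffineMap.lineMap p' r' (t : ℝ))

/-- `X` is, as a metric space, a (real) Banach space; complex Banach spaces are included by
restriction of scalars. -/
def IsBanachSpace : Prop :=
  ∃ (E : Type u) (_ : NormedAddCommGroup E) (_ : NormedSpace ℝ E),
    CompleteSpace E ∧ Nonempty (X ≃ᵢ E)

end Geodesic

/-! ### Pointed metric ultraproducts -/

section Ultraproduct

/-- A bounded real sequence converges along every ultrafilter, to its `limUnder`. -/
theorem tendsto_limUnder_of_bounded (𝒰 : Ultrafilter ℕ) {f : ℕ → ℝ} {a b : ℝ}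
    (hf : ∀ n, f n ∈ Icc a b) : Tendsto f 𝒰 (𝓝 (limUnder (𝒰 : Filter ℕ) f)) := by
  have h : ((𝒰.map f : Ultrafilter ℝ) : Filter ℝ) ≤ 𝓟 (Icc a b) := by
    rw [le_principal_iff]
    exact Filter.mem_map.2 (Filter.univ_mem' hf)
  obtain ⟨l, -, hl⟩ := (isCompact_Icc (a := a) (b := b)).ultrafilter_le_nhds (𝒰.map f) h
  exact tendsto_nhds_limUnder ⟨l, hl⟩

/-- The sequences `(x_n)` with `sup_n d(x_n, w_n) < ∞`.  (The ultrafilter is a parameter because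
the semi-metric depends on it.) -/
structure BoundedSeq (𝒰 : Ultrafilter ℕ) (X : ℕ → CMetSpace.{u}) (w : ∀ n, X n) : Type u where
  seq : ∀ n, X n
  bounded : ∃ C : ℝ, ∀ n, dist (seq n) (w n) ≤ C

variable {𝒰 : Ultrafilter ℕ} {X : ℕ → CMetSpace.{u}} {w : ∀ n, X n}

theorem BoundedSeq.tendsto_dist (x y : BoundedSeq 𝒰 X w) :
    Tendsto (fun n => dist (x.seq n) (y.seq n)) 𝒰
      (𝓝 (limUnder (𝒰 : Filter ℕ) fun n => dist (x.seq n) (y.seq n))) := by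
  obtain ⟨C, hC⟩ := x.bounded
  obtain ⟨D, hD⟩ := y.bounded
  exact tendsto_limUnder_of_bounded 𝒰 (a := 0) (b := C + D) fun n =>
    ⟨dist_nonneg, (dist_triangle_right _ _ (w n)).trans (add_le_add (hC n) (hD n))⟩

/-- The semi-metric `d((x_n), (y_n)) = lim_𝒰 d(x_n, y_n)`. -/
noncomputable instance : PseudoMetricSpace (BoundedSeq 𝒰 X w) where
  dist x y := limUnder (𝒰 : Filter ℕ) fun n => dist (x.seq n) (y.seq n)
  dist_self x := by
    refine tendsto_nhds_unique (x.tendsto_dist x) ?_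
    simp
  dist_comm x y := by simp only [dist_comm]
  dist_triangle x y z :=
    le_of_tendsto_of_tendsto' (x.tendsto_dist z) ((x.tendsto_dist y).add (y.tendsto_dist z))
      fun _ => dist_triangle _ _ _

variable (𝒰 X w)

/-- The metric ultraproduct `lim_𝒰 (X_n, w_n)`: the metric quotient of the bounded sequences. -/
abbrev MetricUltraproduct : Type u := SeparationQuotient (BoundedSeq 𝒰 X w)

end Ultraproduct

/-! ### The six assumptions on a class of metric spaces (classes are taken up to isometry) -/

section Classes

variable (𝒳 : Set CMetSpace.{u})

/-- `(S₊)`: `(X, r d) ∈ 𝒳` for all `(X, d) ∈ 𝒳` and `r ≥ 1`. -/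
def StableScalingUp : Prop :=
  ∀ X ∈ 𝒳, ∀ r : ℝ, 1 ≤ r →
    ∃ Y ∈ 𝒳, ∃ f : X ≃ Y, ∀ a b : X, dist (f a) (f b) = r * dist a b

/-- `(U)`: for some non-principal ultrafilter, `𝒳` is stable under pointed metric ultraproducts. -/
def StableUltraproducts : Prop :=
  ∃ 𝒰 : Ultrafilter ℕ, (∀ n : ℕ, 𝒰 ≠ pure n) ∧
    ∀ (X : ℕ → CMetSpace.{u}) (w : ∀ n, X n), (∀ n, X n ∈ 𝒳) →
      ∃ Y ∈ 𝒳, Nonempty (MetricUltraproduct 𝒰 X w ≃ᵢ Y)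

/-- The six assumptions `(S₊)`, `(U)`, `(NPC1)`, `(NPC2)`, `(NPC3)`, `(TP)`. -/
structure SixAssumptions : Prop where
  scaling : StableScalingUp 𝒳
  ultraproducts : StableUltraproducts 𝒳
  npc1 : ∀ X ∈ 𝒳, NPC1 X
  npc2 : ∀ X ∈ 𝒳, NPC2 X
  npc3 : ∀ X ∈ 𝒳, NPC3 X
  tp : ∀ X ∈ 𝒳, ParallelTransitive X

variable {G : Type v} [Group G]

/-- Relative property `(F_𝒳)` for `G ≥ M`: for every isometric action `α` of `G` on a member `X`
of `𝒳`, the subgroup `M` has a fixed point. -/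
def RelativePropertyF (M : Subgroup G) : Prop :=
  ∀ X ∈ 𝒳, ∀ α : G →* (X ≃ᵢ X), ∃ x : X, ∀ h ∈ M, α h x = x

variable (G) in
/-- Property `(F_𝒳)` for `G`. -/
def PropertyF : Prop := RelativePropertyF 𝒳 (⊤ : Subgroup G)

end Classes

/-! ### The game -/

section Game

variable {G : Type v} [Group G]

/-- The admissible moves `H ⟶ H'` of `(Game⁺)` for `(B 0, B 1, Π)`, where `B = (M, L)`,
`H = (H₁, H₂)` and the indices `1`, `2` are written `0`, `1`. -/
inductive GamePlusMove (B : Fin 2 → Subgroup G) (Pi : Subgroup (MulAut G)) :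
    (Fin 2 → Subgroup G) → (Fin 2 → Subgroup G) → Prop
  /-- Type `(I⁺)`: `h H_i h⁻¹ ≥ B_i` for all `h ∈ P` and all `i`; then `H_i` becomes `⟨H_i, P⟩`. -/
  | typeI (H : Fin 2 → Subgroup G) (P : Set G)
      (hP : ∀ h ∈ P, ∀ i, B i ≤ (H i).map (MulAut.conj h).toMonoidHom) :
      GamePlusMove B Pi H fun i => H i ⊔ Subgroup.closure P
  /-- Type `(II_σ)`: `Λ ⊆ Inn(G) · Π` and `H_{σ⁻¹(i)} ≥ φ(B_i)` for all `φ ∈ Λ` and all `i`; then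
  `H_i` becomes `⟨H_i, ⋃_{φ ∈ Λ} φ(H_{σ(i)})⟩`. -/
  | typeII (H : Fin 2 → Subgroup G) (σ : Equiv.Perm (Fin 2)) (Λ : Set (MulAut G))
      (hΛ : ∀ φ ∈ Λ, ∃ g : G, ∃ π ∈ Pi, φ = MulAut.conj g * π)
      (hσ : ∀ φ ∈ Λ, ∀ i, (B i).map φ.toMonoidHom ≤ H (σ⁻¹ i)) :
      GamePlusMove B Pi H fun i => H i ⊔ ⨆ φ ∈ Λ, (H (σ i)).map φ.toMonoidHom

/-- `(GAME⁺)`: from `(H₁, H₂) = (M, L)` the player reaches `H₁ = G` or `H₂ = G` in finitely many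
moves. -/
def GamePlusWinnable (M L : Subgroup G) (Pi : Subgroup (MulAut G)) : Prop :=
  ∃ H : Fin 2 → Subgroup G,
    Relation.ReflTransGen (GamePlusMove ![M, L] Pi) ![M, L] H ∧ (H 0 = ⊤ ∨ H 1 = ⊤)

end Game

/-!
Suppose that some action of `G` on a member of `𝒳` has no fixed point.  Fix a finite generating set
`S` of `G` invariant under `Π`, and call an action on a member of `𝒳` uniform if the total
displacement of every point by `S` is at least `1 / 2`.  Uniform actions exist: rescale the given
action around points of almost minimal displacement and pass to an ultraproduct
(`exists_isUniformAction`).  By a second ultraproduct, the infimum `D` of the distances between an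
`M`-fixed and an `L`-fixed point, over all uniform actions, is attained by a pair of points
(`exists_isLeast_uniformDistances`).

The invariant of the game (`SixAssumptions.le_pointFixer_of_reachable`) is that in every uniform
action every minimal pair, that is, every pair of fixed points of `M` and `L` at distance `D`, is
fixed by the subgroups of the current position.  Twisting an action by an element of `Inn(G) · Π`
keeps it uniform, so moves of type `(II_σ)` preserve the invariant.  For an element `h` played in a
move of type `(I⁺)`, the translate `(h x, h y)` of a minimal pair `(x, y)` is again one, and so, by
`(NPC1)` and minimality, is the pair of the midpoints of `[x, h x]` and `[y, h y]`.  Hence these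
two segments are parallel, and it remains to exclude that `h` is a translation.  At the end of the
game a point is fixed by all of `G`, which contradicts uniformity.

To exclude translations, note that by `(TP)` all `G`-translates of `[x, h x]` are parallel to it,
since `M` fixes `[x, h x]`, `L` fixes `[y, h y]`, and `M` and `L` generate `G`.

* In a CAT(0) space, `(NPC3)` shows that the distance from `x` to `p = h ^ n x` is `n d(x, h x)`
  for `n = 2 ^ k`.  With the quasi-inner product of Berg and Nikolaev, which satisfies the
  Cauchy–Schwarz inequality, `g ↦ ⟪g x - x, p - x⟫` is a homomorphism on `G` up to errors bounded
  in `n`, and bounded on `M` and `L`.  So it is bounded in `n` for every `g`; but at `h` it is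
  `n d(x, h x) ^ 2` (`IsCAT0.eq_of_segParallel_orbit`).
* In a Banach space the action is affine, and `v = h x - x` is invariant under its linear part.
  Ultraproducts and `(NPC2)` give uniform convexity
  (`uniformConvexSpace_of_stableUltraproducts`), and then there is an invariant functional `f` with
  `f v = ‖v‖` (`exists_invariant_functional`).  Now `g ↦ f (g x - x)` is a homomorphism that
  vanishes on `M` and `L`, so `v = 0` (`eq_of_sub_invariant`).

The invariant functional is found without renorming: take a functional norming `v` that is
stationary under the average of a finite set of generators.  Along the random walk it is a bounded
martingale of functionals, with increments of identically distributed norms.  If these did not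
vanish, testing them on vectors where they are large would give a bounded random sequence in the
space whose initial and final segments are separated in mean; the tree of its dyadic averages
contradicts uniform convexity (`exists_no_separated_random_sequence`, after James).
-/

/-! ### Uniform convexity and martingale trees -/

section UniformConvex

variable {E : Type*} [NormedAddCommGroup E] [NormedSpace ℝ E]

/-- Uniform convexity in terms of squared norms on a ball of radius `C`. -/
theorem exists_norm_sq_midpoint_le [UniformConvexSpace E] {C ε : ℝ} (hC : 0 < C) (hε : 0 < ε) :
    ∃ κ : ℝ, 0 < κ ∧ ∀ a b : E, ‖a‖ ≤ C → ‖b‖ ≤ C → ε ≤ ‖a - b‖ →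
      ‖(1 / 2 : ℝ) • (a + b)‖ ^ 2 ≤ (‖a‖ ^ 2 + ‖b‖ ^ 2) / 2 - κ := by
  obtain ⟨δ, hδ, H⟩ :=
    exists_forall_closed_ball_dist_add_le_two_mul_sub E (div_pos hε hC) 1
  -- Either the norms differ by `τ`, and the scalar parallelogram identity gains `τ ^ 2 / 4`, or
  -- they almost agree, and uniform convexity at the scale of the larger one applies.
  set τ := δ * ε / 8 with hτ
  have hτ0 : 0 < τ := by positivity
  have key : ∀ a b : E, ‖b‖ ≤ ‖a‖ → ‖a‖ ≤ C → ε ≤ ‖a - b‖ →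
      ‖(1 / 2 : ℝ) • (a + b)‖ ^ 2 ≤
        (‖a‖ ^ 2 + ‖b‖ ^ 2) / 2 - min (τ ^ 2 / 4) (ε / 2 * τ) := by
    intro a b hba haC hab
    have hA : ε / 2 ≤ ‖a‖ := by linarith [norm_sub_le a b]
    have hA0 : 0 < ‖a‖ := by linarith
    have hnorm : ‖(1 / 2 : ℝ) • (a + b)‖ = ‖a + b‖ / 2 := by
      rw [norm_smul]; norm_num; ring
    rw [hnorm]
    rcases le_total τ (‖a‖ - ‖b‖) with h | h
    · have h1 : ‖a + b‖ / 2 ≤ (‖a‖ + ‖b‖) / 2 := by linarith [norm_add_le a b]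
      have h2 : (‖a + b‖ / 2) ^ 2 ≤ ((‖a‖ + ‖b‖) / 2) ^ 2 := by gcongr
      have h3 : τ ^ 2 ≤ (‖a‖ - ‖b‖) ^ 2 := by gcongr
      linarith [min_le_left (τ ^ 2 / 4) (ε / 2 * τ)]
    · have h1 : ‖‖a‖⁻¹ • a + ‖a‖⁻¹ • b‖ ≤ 2 * 1 - δ := by
        apply H
        · rw [norm_smul, norm_inv, norm_norm, inv_mul_cancel₀ hA0.ne']
        · rw [norm_smul, norm_inv, norm_norm, inv_mul_le_iff₀ hA0]; linarith
        · rw [← smul_sub, norm_smul, norm_inv, norm_norm, inv_mul_eq_div]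
          gcongr
      rw [← smul_add, norm_smul, norm_inv, norm_norm, inv_mul_le_iff₀ hA0] at h1
      have h2 : (‖a + b‖ / 2) ^ 2 ≤ (‖a‖ * (1 - δ / 2)) ^ 2 := by
        gcongr
        linarith
      have hδ2 : 0 ≤ 1 - δ / 2 := by
        have := (norm_nonneg (a + b)).trans h1
        by_contra hneg
        nlinarith
      have h3 : (‖a‖ * (1 - δ / 2)) ^ 2 ≤ ‖a‖ ^ 2 * (1 - δ / 2) := by
        have : (1 - δ / 2) ^ 2 ≤ 1 - δ / 2 := by nlinarith
        rw [mul_pow]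
        gcongr
      have h4 : ‖a‖ ^ 2 - 2 * τ * ‖a‖ ≤ ‖b‖ ^ 2 := by
        nlinarith [norm_nonneg b]
      have h5 : ε / 2 * τ ≤ ‖a‖ * (δ * ‖a‖ / 2 - τ) := by
        have : τ ≤ δ * ‖a‖ / 2 - τ := by rw [hτ]; nlinarith
        gcongr
      nlinarith [min_le_right (τ ^ 2 / 4) (ε / 2 * τ)]
  refine ⟨min (τ ^ 2 / 4) (ε / 2 * τ), by positivity, fun a b ha hb hab => ?_⟩
  rcases le_total ‖b‖ ‖a‖ with h | h
  · exact key a b h ha hab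
  · have := key b a h hb (by rwa [norm_sub_rev])
    rw [add_comm b a] at this
    linarith

/-- The squared norm is convex at midpoints. -/
theorem norm_sq_midpoint_le (a b : E) :
    ‖(1 / 2 : ℝ) • (a + b)‖ ^ 2 ≤ (‖a‖ ^ 2 + ‖b‖ ^ 2) / 2 := by
  have hnorm : ‖(1 / 2 : ℝ) • (a + b)‖ = ‖a + b‖ / 2 := by
    rw [norm_smul]; norm_num; ring
  rw [hnorm]
  have h2 : (‖a + b‖ / 2) ^ 2 ≤ ((‖a‖ + ‖b‖) / 2) ^ 2 := by
    gcongr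
    exact norm_add_le a b
  nlinarith [sq_nonneg (‖a‖ - ‖b‖)]

/-- The averages of a sequence `z` of vectors over dyadic intervals: `dyadicAverage z j l` is the
mean of `z n` for `l * 2 ^ j ≤ n < (l + 1) * 2 ^ j`. -/
noncomputable def dyadicAverage (z : ℕ → E) : ℕ → ℕ → E
  | 0, l => z l
  | j + 1, l => (1 / 2 : ℝ) • (dyadicAverage z j (2 * l) + dyadicAverage z j (2 * l + 1))

theorem norm_dyadicAverage_le {z : ℕ → E} {C : ℝ} (hz : ∀ n, ‖z n‖ ≤ C) (j l : ℕ) :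
    ‖dyadicAverage z j l‖ ≤ C := by
  induction j generalizing l with
  | zero => exact hz l
  | succ j ih =>
    rw [dyadicAverage, norm_smul]
    have := norm_add_le (dyadicAverage z j (2 * l)) (dyadicAverage z j (2 * l + 1))
    norm_num
    linarith [ih (2 * l), ih (2 * l + 1)]

/-- Averaging James' criterion: in a uniformly convex space there is no long bounded random
sequence `z` for which random functionals `φ m` of norm at most `1` have expectation `c > 0` on
the terms before `m` and `0` on the terms from `m` on.  The dyadic averages of `z` would form a
bounded tree whose siblings are separated in mean. -/
theorem exists_no_separated_random_sequence [UniformConvexSpace E] {C c : ℝ} (hC : 0 < C)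
    (hc : 0 < c) :
    ∃ N : ℕ, ∀ (Ω : Type*) [Fintype Ω] [Nonempty Ω] (z : Ω → ℕ → E) (φ : ℕ → Ω → E →L[ℝ] ℝ),
      (∀ ω n, ‖z ω n‖ ≤ C) → (∀ m ω, ‖φ m ω‖ ≤ 1) →
      (∀ n m, n < m → m ≤ N → ∑ ω, φ m ω (z ω n) = c * Fintype.card Ω) →
      (∀ n m, m ≤ n → n < N → ∑ ω, φ m ω (z ω n) = 0) → False := by
  obtain ⟨κ, hκ, H⟩ := exists_norm_sq_midpoint_le (E := E) hC (half_pos hc)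
  set κ' := κ / (2 * C) with hκ'
  have hκ'0 : 0 < κ' := by positivity
  obtain ⟨k, hk⟩ := exists_nat_gt (C ^ 2 / (κ' * (c / 2)))
  rw [div_lt_iff₀ (by positivity)] at hk
  refine ⟨2 ^ k, fun Ω _ _ z φ hz hφ h1 h2 => ?_⟩
  -- The gain in the midpoint inequality, made linear in `‖a - b‖`.
  have gain : ∀ a b : E, ‖a‖ ≤ C → ‖b‖ ≤ C →
      ‖(1 / 2 : ℝ) • (a + b)‖ ^ 2 ≤
        (‖a‖ ^ 2 + ‖b‖ ^ 2) / 2 - κ' * (‖a - b‖ - c / 2) := by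
    intro a b ha hb
    rcases le_total (c / 2) ‖a - b‖ with h | h
    · have : κ' * (‖a - b‖ - c / 2) ≤ κ' * (2 * C) := by
        gcongr
        linarith [norm_sub_le a b]
      rw [hκ', div_mul_cancel₀ _ (by positivity), ← hκ'] at this
      linarith [H a b ha hb h]
    · have := mul_nonneg hκ'0.le (sub_nonneg.2 h)
      linarith [norm_sq_midpoint_le a b]
  set y : Ω → ℕ → ℕ → E := fun ω => dyadicAverage (z ω) with hy
  have hlt : ∀ j l m, (l + 1) * 2 ^ j ≤ m → m ≤ 2 ^ k →
      ∑ ω, φ m ω (y ω j l) = c * Fintype.card Ω := by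
    intro j
    induction j with
    | zero => intro l m hl hm; exact h1 l m (by omega) hm
    | succ j ih =>
      intro l m hl hm
      have e1 := ih (2 * l) m
        (by rw [pow_succ] at hl; nlinarith [pow_pos (two_pos : (0 : ℕ) < 2) j]) hm
      have e2 := ih (2 * l + 1) m (by rw [pow_succ] at hl; nlinarith) hm
      simp only [hy, dyadicAverage, map_smul, map_add, smul_eq_mul] at e1 e2 ⊢
      rw [← Finset.mul_sum, Finset.sum_add_distrib, e1, e2]
      ring
  have hge : ∀ j l m, m ≤ l * 2 ^ j → (l + 1) * 2 ^ j ≤ 2 ^ k →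
      ∑ ω, φ m ω (y ω j l) = 0 := by
    intro j
    induction j with
    | zero => intro l m hl hm; exact h2 l m (by omega) (by omega)
    | succ j ih =>
      intro l m hl hm
      have hp := pow_pos (two_pos : (0 : ℕ) < 2) j
      have e1 := ih (2 * l) m (by rw [pow_succ] at hl; nlinarith) (by rw [pow_succ] at hm; nlinarith)
      have e2 := ih (2 * l + 1) m (by rw [pow_succ] at hl; nlinarith)
        (by rw [pow_succ] at hm; nlinarith)
      simp only [hy, dyadicAverage, map_smul, map_add, smul_eq_mul] at e1 e2 ⊢
      rw [← Finset.mul_sum, Finset.sum_add_distrib, e1, e2]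
      ring
  have hyC : ∀ ω j l, ‖y ω j l‖ ≤ C := fun ω j l => norm_dyadicAverage_le (hz ω) j l
  -- Siblings are separated in mean: test their difference against `φ m`, `m` the point between.
  have hsep : ∀ j l, (l + 1) * 2 ^ (j + 1) ≤ 2 ^ k →
      c * Fintype.card Ω ≤ ∑ ω, ‖y ω j (2 * l) - y ω j (2 * l + 1)‖ := by
    intro j l hl
    have hp := pow_pos (two_pos : (0 : ℕ) < 2) j
    have e1 := hlt j (2 * l) ((2 * l + 1) * 2 ^ j) le_rfl (by rw [pow_succ] at hl; nlinarith)
    have e2 := hge j (2 * l + 1) ((2 * l + 1) * 2 ^ j) le_rfl (by rw [pow_succ] at hl; nlinarith)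
    calc c * Fintype.card Ω
        = ∑ ω, φ ((2 * l + 1) * 2 ^ j) ω (y ω j (2 * l) - y ω j (2 * l + 1)) := by
          simp only [map_sub, Finset.sum_sub_distrib, e1, e2, sub_zero]
      _ ≤ _ := by
          refine Finset.sum_le_sum fun ω _ => (le_abs_self _).trans ?_
          exact ((φ _ ω).le_of_opNorm_le (hφ _ ω) _).trans (one_mul _).le
  have hdec : ∀ j l, (l + 1) * 2 ^ j ≤ 2 ^ k →
      ∑ ω, ‖y ω j l‖ ^ 2 ≤ Fintype.card Ω * (C ^ 2 - j * (κ' * (c / 2))) := by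
    intro j
    induction j with
    | zero =>
      intro l hl
      calc ∑ ω, ‖y ω 0 l‖ ^ 2 ≤ ∑ _ω : Ω, C ^ 2 := by
            refine Finset.sum_le_sum fun ω _ => ?_
            gcongr
            exact hyC ω 0 l
        _ = _ := by simp
    | succ j ih =>
      intro l hl
      have hp := pow_pos (two_pos : (0 : ℕ) < 2) j
      have e1 := ih (2 * l) (by rw [pow_succ] at hl; nlinarith)
      have e2 := ih (2 * l + 1) (by rw [pow_succ] at hl; nlinarith)
      have e3 := hsep j l hl
      calc ∑ ω, ‖y ω (j + 1) l‖ ^ 2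
          ≤ ∑ ω, ((‖y ω j (2 * l)‖ ^ 2 + ‖y ω j (2 * l + 1)‖ ^ 2) / 2
              - κ' * (‖y ω j (2 * l) - y ω j (2 * l + 1)‖ - c / 2)) :=
            Finset.sum_le_sum fun ω _ => gain _ _ (hyC _ _ _) (hyC _ _ _)
        _ = (∑ ω, ‖y ω j (2 * l)‖ ^ 2 + ∑ ω, ‖y ω j (2 * l + 1)‖ ^ 2) / 2
              - κ' * (∑ ω, ‖y ω j (2 * l) - y ω j (2 * l + 1)‖ - Fintype.card Ω * (c / 2)) := by
            rw [Finset.sum_sub_distrib, ← Finset.sum_div, Finset.sum_add_distrib,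
              ← Finset.mul_sum, Finset.sum_sub_distrib]
            simp
        _ ≤ _ := by
            have := mul_le_mul_of_nonneg_left e3 hκ'0.le
            push_cast
            nlinarith
  have hfin := hdec k 0 (by simp)
  have hcard : (0 : ℝ) < Fintype.card Ω := by exact_mod_cast Fintype.card_pos
  have hneg : (Fintype.card Ω : ℝ) * (C ^ 2 - k * (κ' * (c / 2))) < 0 :=
    mul_neg_of_pos_of_neg hcard (by linarith)
  have hpos : 0 ≤ ∑ ω, ‖y ω k 0‖ ^ 2 := Finset.sum_nonneg fun ω _ => by positivity
  linarith

end UniformConvex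

/-! ### Invariant functionals -/

section InvariantFunctional

variable {E : Type*} [NormedAddCommGroup E] [NormedSpace ℝ E]

/-- A contraction `T` fixing `v` admits a `T`-invariant functional that norms `v`: take a weak-*
cluster point of the averages of a norming functional along the powers of `T`. -/
theorem exists_stationary_functional (T : E →L[ℝ] E) (hT : ∀ x, ‖T x‖ ≤ ‖x‖) {v : E}
    (hv : T v = v) :
    ∃ f : E →L[ℝ] ℝ, ‖f‖ ≤ 1 ∧ f v = ‖v‖ ∧ ∀ x, f (T x) = f x := by
  obtain ⟨f₀, hf₀, hf₀v⟩ := exists_dual_vector'' ℝ v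
  have hf₀' : ∀ x, |f₀ x| ≤ ‖x‖ := fun x =>
    (f₀.le_of_opNorm_le hf₀ x).trans (one_mul _).le
  have hpow : ∀ n x, ‖(T ^ n) x‖ ≤ ‖x‖ := by
    intro n x
    induction n with
    | zero => simp
    | succ n ih => rw [pow_succ']; exact (hT _).trans ih
  have hpowv : ∀ n, (T ^ n) v = v := by
    intro n
    induction n with
    | zero => simp
    | succ n ih => rw [pow_succ']; change T ((T ^ n) v) = v; rw [ih, hv]
  set F : ℕ → E →L[ℝ] ℝ := fun N =>
    ((N : ℝ) + 1)⁻¹ • ∑ n ∈ Finset.range (N + 1), f₀.comp (T ^ n) with hF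
  have hFx : ∀ N x, F N x = ((N : ℝ) + 1)⁻¹ * ∑ n ∈ Finset.range (N + 1), f₀ ((T ^ n) x) := by
    intro N x
    simp [hF]
  have hFnorm : ∀ N, ‖F N‖ ≤ 1 := by
    intro N
    refine ContinuousLinearMap.opNorm_le_bound _ zero_le_one fun x => ?_
    rw [hFx, Real.norm_eq_abs, abs_mul, abs_inv, abs_of_pos (by positivity : (0 : ℝ) < N + 1),
      one_mul, inv_mul_le_iff₀ (by positivity)]
    calc |∑ n ∈ Finset.range (N + 1), f₀ ((T ^ n) x)|
        ≤ ∑ n ∈ Finset.range (N + 1), |f₀ ((T ^ n) x)| := Finset.abs_sum_le_sum_abs _ _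
      _ ≤ ∑ _n ∈ Finset.range (N + 1), ‖x‖ :=
          Finset.sum_le_sum fun n _ => (hf₀' _).trans (hpow n x)
      _ = _ := by simp
  have hmem : ((hyperfilter ℕ).map fun N => StrongDual.toWeakDual (F N) :
      Ultrafilter (WeakDual ℝ E)) ≤
      𝓟 (WeakDual.toStrongDual ⁻¹' Metric.closedBall (0 : StrongDual ℝ E) 1) := by
    rw [le_principal_iff]
    refine Filter.mem_map.2 (Filter.univ_mem' fun N => ?_)
    simpa using hFnorm N
  obtain ⟨f, hf, hlim⟩ :=
    (WeakDual.isCompact_closedBall (0 : StrongDual ℝ E) 1).ultrafilter_le_nhds _ hmem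
  have hlimx : ∀ x, Tendsto (fun N => F N x) (hyperfilter ℕ) (𝓝 (f x)) := fun x =>
    ((WeakDual.eval_continuous x).tendsto f).comp hlim
  refine ⟨WeakDual.toStrongDual f, by simpa using hf, ?_, fun x => ?_⟩
  · refine tendsto_nhds_unique (hlimx v) ?_
    have : ∀ N, F N v = ‖v‖ := by
      intro N
      rw [hFx]
      simp only [hpowv, hf₀v]
      simp
      field_simp
    simp only [this]
    exact tendsto_const_nhds
  · have h1 : Tendsto (fun N => F N (T x) - F N x) (hyperfilter ℕ) (𝓝 (f (T x) - f x)) :=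
      (hlimx (T x)).sub (hlimx x)
    have h2 : Tendsto (fun N => F N (T x) - F N x) (hyperfilter ℕ) (𝓝 0) := by
      have hb : ∀ N, |F N (T x) - F N x| ≤ 2 * ‖x‖ / ((N : ℝ) + 1) := by
        intro N
        have hs : F N (T x) - F N x = ((N : ℝ) + 1)⁻¹ * (f₀ ((T ^ (N + 1)) x) - f₀ x) := by
          rw [hFx, hFx, ← mul_sub, ← Finset.sum_sub_distrib]
          congr 1
          have : ∀ n, f₀ ((T ^ n) (T x)) = f₀ ((T ^ (n + 1)) x) := fun n => by
            rw [pow_succ]; rfl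
          simp only [this]
          rw [Finset.sum_range_sub (fun n => f₀ ((T ^ n) x))]
          simp
        rw [hs, abs_mul, abs_inv, abs_of_pos (by positivity : (0 : ℝ) < N + 1), inv_mul_eq_div]
        gcongr
        have h3 := (hf₀' ((T ^ (N + 1)) x)).trans (hpow _ x)
        have h4 := hf₀' x
        have h5 := abs_sub (f₀ ((T ^ (N + 1)) x)) (f₀ x)
        linarith
      refine squeeze_zero_norm hb ?_
      refine Tendsto.mono_left ?_ Nat.hyperfilter_le_atTop
      exact tendsto_const_nhds.div_atTop
        (tendsto_atTop_add_const_right _ _ tendsto_natCast_atTop_atTop)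
    exact sub_eq_zero.1 (tendsto_nhds_unique h1 h2)

variable {G ι : Type*} [Group G]

/-- The left random walk on `G` with steps `s (ω 0), s (ω 1), …`. -/
def leftWalk (s : ι → G) (ω : ℕ → ι) : ℕ → G
  | 0 => 1
  | n + 1 => s (ω n) * leftWalk s ω n

theorem leftWalk_update (s : ι → G) (ω : ℕ → ι) (i : ι) {m n : ℕ} (h : m ≤ n) :
    leftWalk s (Function.update ω n i) m = leftWalk s ω m := by
  induction m with
  | zero => rfl
  | succ m ih =>
    rw [leftWalk, leftWalk, ih (by omega), Function.update_of_ne (by omega)]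

/-- The extension of a finite word to an infinite one by a constant letter. -/
def extendWord (i₀ : ι) {N : ℕ} (ω : Fin N → ι) (n : ℕ) : ι :=
  if h : n < N then ω ⟨n, h⟩ else i₀

/-- Resampling the `n`-th letter of a uniformly random word does not change expectations. -/
theorem card_mul_sum_extendWord [Fintype ι] (i₀ : ι) {N n : ℕ} (hn : n < N)
    (H : (ℕ → ι) → ℝ) :
    Fintype.card ι * ∑ ω : Fin N → ι, H (extendWord i₀ ω) =
      ∑ ω : Fin N → ι, ∑ i, H (Function.update (extendWord i₀ ω) n i) := by
  classical
  have hupd : ∀ (ω : Fin N → ι) i,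
      extendWord i₀ (Function.update ω ⟨n, hn⟩ i) = Function.update (extendWord i₀ ω) n i := by
    intro ω i
    funext m
    by_cases hmn : m = n
    · subst hmn; simp [extendWord, hn]
    · rw [Function.update_of_ne hmn]
      unfold extendWord
      split_ifs with h
      · rw [Function.update_of_ne]
        simpa [Fin.ext_iff] using hmn
      · rfl
  -- Exchanging the `n`-th letter of the word with the new letter is an involution.
  let e : (Fin N → ι) × ι ≃ (Fin N → ι) × ι :=
    { toFun := fun p => (Function.update p.1 ⟨n, hn⟩ p.2, p.1 ⟨n, hn⟩)
      invFun := fun p => (Function.update p.1 ⟨n, hn⟩ p.2, p.1 ⟨n, hn⟩)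
      left_inv := fun p => by simp
      right_inv := fun p => by simp }
  have h1 := Equiv.sum_comp e fun p => H (extendWord i₀ p.1)
  rw [Fintype.sum_prod_type, Fintype.sum_prod_type] at h1
  simp only [e, Equiv.coe_fn_mk, hupd, Finset.sum_const, Finset.card_univ, nsmul_eq_mul] at h1
  rw [h1, Finset.mul_sum]

/-- In a uniformly convex space, a functional that is stationary for a random walk is invariant.
Its values along the walk form a bounded martingale of functionals with non-vanishing increments,
which, tested on suitable vectors, would contradict uniform convexity. -/
theorem invariant_of_stationary [UniformConvexSpace E] [Fintype ι] (ρ : G →* (E ≃ₗᵢ[ℝ] E))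
    (s : ι → G) (f : E →L[ℝ] ℝ) (hf : ‖f‖ ≤ 1)
    (hstat : ∀ x, ∑ i, f (ρ (s i) x) = Fintype.card ι * f x) (i₁ : ι) (z : E) :
    f (ρ (s i₁) z) = f z := by
  by_contra hne
  set ψ : ι → ℝ := fun i => f (ρ (s i) z) - f z with hψ
  have hψsum : ∑ i, ψ i = 0 := by
    simp [hψ, Finset.sum_sub_distrib, hstat]
  have hK : (0 : ℝ) < Fintype.card ι := by
    have : Nonempty ι := ⟨i₁⟩
    exact_mod_cast Fintype.card_pos
  set c : ℝ := (∑ i, ψ i ^ 2) / Fintype.card ι with hc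
  have hsq : 0 < ∑ i, ψ i ^ 2 :=
    Finset.sum_pos' (fun i _ => sq_nonneg _)
      ⟨i₁, Finset.mem_univ _, by have : ψ i₁ ≠ 0 := sub_ne_zero.2 hne; positivity⟩
  have hc0 : 0 < c := by positivity
  set C : ℝ := (∑ i, |ψ i|) * ‖z‖ + 1 with hC
  have hC0 : 0 < C := by positivity
  obtain ⟨N, hN⟩ := exists_no_separated_random_sequence (E := E) hC0 hc0
  -- `Z n` is a martingale difference in `E`, predictable up to the scalar `ψ (ω n)`; it is paired
  -- with the martingale `Φ m = f ∘ ρ (w m)` of functionals, where `w` is the walk.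
  let Z : (ℕ → ι) → ℕ → E := fun ω n => ψ (ω n) • (ρ (leftWalk s ω n))⁻¹ z
  let Φ : ℕ → (ℕ → ι) → E →L[ℝ] ℝ := fun m ω =>
    f.comp (ρ (leftWalk s ω m)).toLinearIsometry.toContinuousLinearMap
  have hΦ : ∀ m ω x, Φ m ω x = f (ρ (leftWalk s ω m) x) := fun _ _ _ => rfl
  have hsucc : ∀ m ω x, Φ (m + 1) ω x = f (ρ (s (ω m)) (ρ (leftWalk s ω m) x)) := by
    intro m ω x
    rw [hΦ, leftWalk, map_mul]; rfl
  have : Nonempty (Fin N → ι) := ⟨fun _ => i₁⟩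
  have hZupd : ∀ ω n m i, n < m → Z (Function.update ω m i) n = Z ω n := by
    intro ω n m i hnm
    simp only [Z]
    rw [leftWalk_update s ω i hnm.le, Function.update_of_ne hnm.ne]
  refine hN (Fin N → ι) (fun ω => Z (extendWord i₁ ω)) (fun m ω => Φ m (extendWord i₁ ω))
    ?_ ?_ ?_ ?_
  · intro ω n
    simp only [Z]
    rw [norm_smul]
    have h1 : ‖(ρ (leftWalk s (extendWord i₁ ω) n))⁻¹ z‖ = ‖z‖ := LinearIsometryEquiv.norm_map _ _
    have h2 : ‖ψ (extendWord i₁ ω n)‖ ≤ ∑ i, |ψ i| :=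
      Finset.single_le_sum (f := fun i => |ψ i|) (fun i _ => abs_nonneg _) (Finset.mem_univ _)
    rw [h1, hC]
    have := mul_le_mul_of_nonneg_right h2 (norm_nonneg z)
    linarith
  · intro m ω
    refine ContinuousLinearMap.opNorm_le_bound _ zero_le_one fun x => ?_
    rw [hΦ]
    refine (f.le_of_opNorm_le hf _).trans ?_
    rw [LinearIsometryEquiv.norm_map]
  · -- The expectation is `c` right after step `n`, and stays so by the martingale property.
    intro n m hnm
    induction m, hnm using Nat.le_induction with
    | base =>
      intro hN'
      have h := card_mul_sum_extendWord i₁ (N := N) hN' fun ω => Φ (n + 1) ω (Z ω n)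
      have h2 : ∀ (ω : ℕ → ι) i, Φ (n + 1) (Function.update ω n i) (Z (Function.update ω n i) n)
          = ψ i * f (ρ (s i) z) := by
        intro ω i
        rw [hsucc, leftWalk_update s ω i le_rfl]
        simp only [Z, leftWalk_update s ω i le_rfl, Function.update_self, map_smul, smul_eq_mul]
        congr 3
        exact LinearIsometryEquiv.apply_symm_apply _ _
      simp only [h2] at h
      have h3 : ∑ i, ψ i * f (ρ (s i) z) = ∑ i, ψ i ^ 2 := by
        have : ∀ i, ψ i * f (ρ (s i) z) = ψ i ^ 2 + ψ i * f z := fun i => by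
          simp only [hψ]; ring
        simp only [this]
        rw [Finset.sum_add_distrib, ← Finset.sum_mul, hψsum]
        ring
      rw [h3, Finset.sum_const, Finset.card_univ, nsmul_eq_mul] at h
      rw [hc]
      field_simp
      linarith
    | succ m hnm ih =>
      intro hN'
      rw [← ih (by omega)]
      have h := card_mul_sum_extendWord i₁ (N := N) (Nat.lt_of_succ_le hN')
        fun ω => Φ (m + 1) ω (Z ω n)
      have h2 : ∀ (ω : ℕ → ι) i, Φ (m + 1) (Function.update ω m i) (Z (Function.update ω m i) n)
          = f (ρ (s i) (ρ (leftWalk s ω m) (Z ω n))) := by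
        intro ω i
        rw [hsucc, leftWalk_update s ω i le_rfl, hZupd ω n m i hnm, Function.update_self]
      simp only [h2, hstat] at h
      rw [← Finset.mul_sum] at h
      exact mul_left_cancel₀ hK.ne' h
  · -- `Φ m` and the direction of `Z n` do not depend on the `n`-th letter, and `ψ` has mean zero.
    intro n m hmn hN'
    have h := card_mul_sum_extendWord i₁ (N := N) hN' fun ω => Φ m ω (Z ω n)
    have h2 : ∀ (ω : ℕ → ι) i, Φ m (Function.update ω n i) (Z (Function.update ω n i) n)
        = ψ i * f (ρ (leftWalk s ω m) ((ρ (leftWalk s ω n))⁻¹ z)) := by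
      intro ω i
      rw [hΦ, leftWalk_update s ω i hmn]
      simp only [Z, leftWalk_update s ω i le_rfl, Function.update_self, map_smul, smul_eq_mul]
    simp only [h2, ← Finset.sum_mul, hψsum, zero_mul, Finset.sum_const_zero] at h
    exact (mul_eq_zero.1 h).resolve_left hK.ne'

/-- An isometric linear representation of a finitely generated group on a uniformly convex space
admits, for every invariant vector `v`, an invariant functional norming `v`. -/
theorem exists_invariant_functional [UniformConvexSpace E] [Group.FG G]
    (ρ : G →* (E ≃ₗᵢ[ℝ] E)) {v : E} (hv : ∀ g, ρ g v = v) :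
    ∃ f : E →L[ℝ] ℝ, f v = ‖v‖ ∧ ∀ g x, f (ρ g x) = f x := by
  classical
  obtain ⟨S, hS⟩ := Group.FG.out (G := G)
  -- The identity is added to the generators so that the average over the steps makes sense.
  set s : Option S → G := fun o => o.elim 1 (fun g => (g : G)) with hs
  set k : ℝ := (Fintype.card (Option S) : ℝ) with hk
  have hk0 : 0 < k := by
    rw [hk]; exact_mod_cast Fintype.card_pos
  set T : E →L[ℝ] E := k⁻¹ • ∑ i, (ρ (s i)).toLinearIsometry.toContinuousLinearMap with hT
  have hTx : ∀ x, T x = k⁻¹ • ∑ i, ρ (s i) x := by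
    intro x
    rw [hT, smul_apply, sum_apply]
    rfl
  obtain ⟨f, hf, hfv, hfT⟩ := exists_stationary_functional T (v := v)
    (by
      intro x
      rw [hTx, norm_smul, norm_inv, Real.norm_of_nonneg hk0.le, inv_mul_le_iff₀ hk0]
      refine (norm_sum_le _ _).trans ?_
      simp [hk])
    (by
      rw [hTx]
      simp only [hv, Finset.sum_const, Finset.card_univ]
      rw [← Nat.cast_smul_eq_nsmul ℝ, smul_smul, inv_mul_cancel₀ hk0.ne', one_smul])
  refine ⟨f, hfv, fun g => ?_⟩
  have hinv := invariant_of_stationary ρ s f hf (by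
    intro x
    have := hfT x
    rw [hTx, map_smul, map_sum, smul_eq_mul, inv_mul_eq_iff_eq_mul₀ hk0.ne'] at this
    exact this)
  have hg : g ∈ Subgroup.closure (S : Set G) := hS ▸ Subgroup.mem_top g
  induction hg using Subgroup.closure_induction with
  | mem g hg => exact hinv (some ⟨g, hg⟩)
  | one => intro x; simp
  | mul a b _ _ ha hb =>
    intro x
    rw [map_mul, ← hb x, ← ha (ρ b x)]; rfl
  | inv a _ ha =>
    intro x
    rw [← ha, map_inv]
    congr 1
    exact LinearIsometryEquiv.apply_symm_apply _ _

end InvariantFunctional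

/-! ### The quasi-inner product in CAT(0) spaces -/

section CAT0

/-- Three numbers satisfying the triangle inequalities are the side lengths of a triangle in the
Euclidean plane. -/
theorem exists_euclidean_triangle {a b c : ℝ} (ha : 0 ≤ a) (hb : 0 ≤ b) (hc : 0 ≤ c)
    (h1 : a ≤ b + c) (h2 : b ≤ a + c) (h3 : c ≤ a + b) :
    ∃ p q r : EuclideanSpace ℝ (Fin 2), dist p q = a ∧ dist p r = b ∧ dist q r = c := by
  rcases ha.eq_or_lt with rfl | ha'
  · have : b = c := by linarith
    subst this
    refine ⟨0, 0, !₂[b, 0], by simp, ?_, ?_⟩ <;>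
    · rw [EuclideanSpace.dist_eq]
      simp [Fin.sum_univ_two, Real.sqrt_sq hb]
  · set t := (a ^ 2 + b ^ 2 - c ^ 2) / (2 * a) with ht
    have hta : 2 * a * t = a ^ 2 + b ^ 2 - c ^ 2 := by rw [ht]; field_simp
    have hc2 : c ^ 2 ≤ (a + b) ^ 2 := by gcongr
    have hc1 : (a - b) ^ 2 ≤ c ^ 2 := by
      apply sq_le_sq'
      · linarith
      · linarith
    have htb : t ^ 2 ≤ b ^ 2 := by
      apply sq_le_sq' <;> nlinarith
    refine ⟨0, !₂[a, 0], !₂[t, √(b ^ 2 - t ^ 2)], ?_, ?_, ?_⟩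
    · rw [EuclideanSpace.dist_eq]
      simp [Fin.sum_univ_two, Real.sqrt_sq ha]
    · rw [EuclideanSpace.dist_eq]
      simp [Fin.sum_univ_two, Real.dist_eq, Real.sq_sqrt (sub_nonneg.2 htb), Real.sqrt_sq hb]
    · have : (a - t) ^ 2 + √(b ^ 2 - t ^ 2) ^ 2 = c ^ 2 := by
        rw [Real.sq_sqrt (sub_nonneg.2 htb)]
        linarith
      rw [EuclideanSpace.dist_eq]
      simp [Fin.sum_univ_two, Real.dist_eq, this, Real.sqrt_sq hc]

/-- Stewart's formula. -/
theorem dist_lineMap_sq {V : Type*} [NormedAddCommGroup V] [InnerProductSpace ℝ V] (p q r : V)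
    (s : ℝ) : dist (AffineMap.lineMap p q s) r ^ 2 =
      (1 - s) * dist p r ^ 2 + s * dist q r ^ 2 - s * (1 - s) * dist p q ^ 2 := by
  have h1 : AffineMap.lineMap p q s - r = (1 - s) • (p - r) + s • (q - r) := by
    rw [AffineMap.lineMap_apply_module]
    module
  have h2 : p - q = (p - r) - (q - r) := by abel
  rw [dist_eq_norm, dist_eq_norm, dist_eq_norm, dist_eq_norm, h1, h2]
  generalize p - r = a, q - r = b
  rw [norm_add_sq_real, norm_sub_sq_real, norm_smul, norm_smul, real_inner_smul_left,
    real_inner_smul_right, mul_pow, mul_pow, Real.norm_eq_abs, Real.norm_eq_abs, sq_abs, sq_abs]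
  ring

variable {X : Type*} [MetricSpace X]

/-- The inequality of Bruhat and Tits, at an arbitrary point of the geodesic. -/
theorem IsCAT0.dist_sq_le (hX : IsCAT0 X) {p q : X} {γ : unitInterval → X}
    (hγ : IsGeodesic γ p q) (r : X) (s : unitInterval) :
    dist (γ s) r ^ 2 ≤
      (1 - s) * dist p r ^ 2 + s * dist q r ^ 2 - s * (1 - s) * dist p q ^ 2 := by
  obtain ⟨γ', hγ'⟩ := hX.1 p r
  obtain ⟨p', q', r', h1, h2, h3⟩ := exists_euclidean_triangle (dist_nonneg (x := p) (y := q))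
    (dist_nonneg (x := p) (y := r)) (dist_nonneg (x := q) (y := r))
    (by linarith [dist_triangle p r q, dist_comm r q]) (by linarith [dist_triangle p q r])
    (by linarith [dist_triangle q p r, dist_comm q p])
  have h := hX.2 p q r γ γ' hγ hγ' p' q' r' h1 h2 h3 s 1
  rw [hγ'.2.1, Icc.coe_one, AffineMap.lineMap_apply_one] at h
  calc dist (γ s) r ^ 2 ≤ dist (AffineMap.lineMap p' q' (s : ℝ)) r' ^ 2 := by gcongr
    _ = _ := by rw [dist_lineMap_sq, h1, h2, h3]

/-- The quasi-inner product of Berg and Nikolaev; it stands for `⟪b - a, d - c⟫`. -/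
noncomputable def quasiInner (a b c d : X) : ℝ :=
  (dist a d ^ 2 + dist b c ^ 2 - dist a c ^ 2 - dist b d ^ 2) / 2

theorem quasiInner_add_left (a b c x y : X) :
    quasiInner a b x y + quasiInner b c x y = quasiInner a c x y := by
  unfold quasiInner; ring

theorem quasiInner_add_right (x y a b c : X) :
    quasiInner x y a b + quasiInner x y b c = quasiInner x y a c := by
  unfold quasiInner; ring

theorem quasiInner_swap_left (a b x y : X) : quasiInner b a x y = -quasiInner a b x y := by
  unfold quasiInner; ring

theorem quasiInner_map (g : X ≃ᵢ X) (a b c d : X) :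
    quasiInner (g a) (g b) (g c) (g d) = quasiInner a b c d := by
  unfold quasiInner; simp only [g.dist_eq]

/-- The Cauchy–Schwarz inequality for the quasi-inner product. -/
theorem IsCAT0.quasiInner_le (hX : IsCAT0 X) (a b c d : X) :
    quasiInner a b c d ≤ dist a b * dist c d := by
  rcases (dist_nonneg (x := a) (y := b)).eq_or_lt with h | hab
  · have := dist_eq_zero.1 h.symm
    subst this
    simp [quasiInner]
  rcases (dist_nonneg (x := c) (y := d)).eq_or_lt with h | hcd
  · have := dist_eq_zero.1 h.symm
    subst this
    simp [quasiInner]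
  obtain ⟨γ, hγ⟩ := hX.1 a d
  -- Compare `b` and `c` with the point dividing the diagonal `[a, d]` at ratio `ab : cd`.
  set u := dist a b with hu
  set w := dist c d with hw
  have huw : 0 < u + w := by linarith
  set s : unitInterval := ⟨u / (u + w), by positivity, by rw [div_le_one huw]; linarith⟩ with hs
  have hs' : (s : ℝ) = u / (u + w) := rfl
  have hs1 : 1 - (s : ℝ) = w / (u + w) := by rw [hs']; field_simp; ring
  have hb := hX.dist_sq_le hγ b s
  have hc := hX.dist_sq_le hγ c s
  rw [hs1, hs'] at hb hc
  rw [dist_comm d b, ← hu] at hb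
  rw [dist_comm d c, ← hw] at hc
  have ht : dist b c ≤ dist (γ s) b + dist (γ s) c := dist_triangle_left _ _ _
  set m := dist (γ s) b
  set n := dist (γ s) c
  have hm : 0 ≤ m := dist_nonneg
  have hn : 0 ≤ n := dist_nonneg
  have h1 : dist b c ^ 2 ≤ (m + n) ^ 2 := by gcongr
  have h2 : u * w * (m + n) ^ 2 ≤ (u + w) * (w * m ^ 2 + u * n ^ 2) := by
    nlinarith [sq_nonneg (w * m - u * n)]
  have hb' : (u + w) ^ 2 * m ^ 2 ≤
      (u + w) * w * u ^ 2 + (u + w) * u * dist b d ^ 2 - u * w * dist a d ^ 2 := by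
    calc (u + w) ^ 2 * m ^ 2 ≤ (u + w) ^ 2 * _ := mul_le_mul_of_nonneg_left hb (by positivity)
      _ = _ := by field_simp
  have hc' : (u + w) ^ 2 * n ^ 2 ≤
      (u + w) * w * dist a c ^ 2 + (u + w) * u * w ^ 2 - u * w * dist a d ^ 2 := by
    calc (u + w) ^ 2 * n ^ 2 ≤ (u + w) ^ 2 * _ := mul_le_mul_of_nonneg_left hc (by positivity)
      _ = _ := by field_simp
  have h3 : u * w * (u + w) * dist b c ^ 2 ≤ u * w * (u + w) *
      (2 * u * w + dist b d ^ 2 + dist a c ^ 2 - dist a d ^ 2) := by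
    have e1 := mul_le_mul_of_nonneg_left h1 (by positivity : 0 ≤ u * w * (u + w))
    have e2 := mul_le_mul_of_nonneg_left h2 huw.le
    have e4 := mul_le_mul_of_nonneg_left hb' hcd.le
    have e5 := mul_le_mul_of_nonneg_left hc' hab.le
    linarith
  have h4 := le_of_mul_le_mul_left h3 (by positivity)
  unfold quasiInner
  linarith

theorem IsCAT0.abs_quasiInner_le (hX : IsCAT0 X) (a b c d : X) :
    |quasiInner a b c d| ≤ dist a b * dist c d := by
  refine abs_le.2 ⟨?_, hX.quasiInner_le a b c d⟩
  have := hX.quasiInner_le b a c d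
  rw [quasiInner_swap_left, dist_comm b a] at this
  linarith

end CAT0

/-! ### Parallel segments -/

section Parallel

variable {X : Type*} [MetricSpace X]

theorem IsGeodesic.map {γ : unitInterval → X} {x y : X} (h : IsGeodesic γ x y) (e : X ≃ᵢ X) :
    IsGeodesic (e ∘ γ) (e x) (e y) :=
  ⟨congrArg e h.1, congrArg e h.2.1, fun s t => by
    simp only [Function.comp_apply, e.dist_eq, h.2.2]⟩

theorem IsGeodesic.dist_left_half {γ : unitInterval → X} {x y : X} (h : IsGeodesic γ x y) :
    dist x (γ unitHalf) = dist x y / 2 := by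
  have := h.2.2 0 unitHalf
  rw [h.1] at this
  rw [this]
  simp [unitHalf, abs_of_pos]
  ring

theorem IsGeodesic.dist_half_right {γ : unitInterval → X} {x y : X} (h : IsGeodesic γ x y) :
    dist (γ unitHalf) y = dist x y / 2 := by
  have := h.2.2 unitHalf 1
  rw [h.2.1] at this
  rw [this]
  have : |(1 / 2 : ℝ) - 1| = 1 / 2 := by norm_num [abs_of_neg]
  simp only [unitHalf, Icc.coe_one, this]
  ring

theorem SegParallel.map {x y x' y' : X} (h : SegParallel x y x' y') (e : X ≃ᵢ X) :
    SegParallel (e x) (e y) (e x') (e y') := by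
  obtain ⟨γ, γ', h1, h2, h3, h4⟩ := h
  refine ⟨e ∘ γ, e ∘ γ', h1.map e, h2.map e, ?_, ?_⟩
  · simpa only [e.dist_eq] using h3
  · simpa only [Function.comp_apply, e.dist_eq] using h4

theorem SegParallel.symm {x y x' y' : X} (h : SegParallel x y x' y') : SegParallel x' y' x y := by
  obtain ⟨γ, γ', h1, h2, h3, h4⟩ := h
  refine ⟨γ', γ, h2, h1, ?_, ?_⟩
  · simpa only [dist_comm] using h3
  · simpa only [dist_comm] using h4

theorem SegParallel.refl_left {x y x' y' : X} (h : SegParallel x y x' y') :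
    SegParallel x y x y := by
  obtain ⟨γ, -, h1, -⟩ := h
  exact ⟨γ, γ, h1, h1, by simp, by simp⟩

theorem SegParallel.dist_eq {x y x' y' : X} (h : SegParallel x y x' y') :
    dist x x' = dist y y' := by
  obtain ⟨-, -, -, -, h, -⟩ := h
  exact h

/-- `(NPC2)`, applied to a degenerate segment: two points are equal if the midpoint of a geodesic
between them is as far from some point as both of them are. -/
theorem NPC2.eq_of_dist_half_eq (h : NPC2 X) {x a b : X} {γ : unitInterval → X}
    (hγ : IsGeodesic γ a b) (hab : dist x a = dist x b) (hm : dist x b = dist x (γ unitHalf)) :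
    a = b := by
  have hx : IsGeodesic (fun _ => x) x x := ⟨rfl, rfl, fun s t => by simp⟩
  have := (h x x a b ⟨fun _ => x, γ, hx, hγ, hab, hm⟩).dist_eq
  rwa [dist_self, eq_comm, dist_eq_zero] at this

variable {G : Type*} [Group G] {M L : Subgroup G}

/-- If `M` fixes the ends of a segment, `L` fixes the ends of a parallel one, and `M` and `L`
generate `G`, then `G` preserves the parallelism class of these segments. -/
theorem ParallelTransitive.segParallel_orbit (hX : ParallelTransitive X) (α : G →* (X ≃ᵢ X))
    (hgen : Subgroup.closure ((M : Set G) ∪ (L : Set G)) = ⊤) {x x' y y' : X}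
    (hx : ∀ g ∈ M, α g x = x) (hx' : ∀ g ∈ M, α g x' = x')
    (hy : ∀ g ∈ L, α g y = y) (hy' : ∀ g ∈ L, α g y' = y')
    (hpar : SegParallel x x' y y') (g : G) :
    SegParallel (α g x) (α g x') x x' := by
  have hg : g ∈ Subgroup.closure ((M : Set G) ∪ (L : Set G)) := hgen ▸ Subgroup.mem_top g
  induction hg using Subgroup.closure_induction with
  | mem g hg =>
    rcases hg with hg | hg
    · rw [hx g hg, hx' g hg]; exact hpar.refl_left
    · have := hpar.map (α g)
      rw [hy g hg, hy' g hg] at this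
      exact hX _ _ _ _ _ _ this hpar.symm
  | one => simpa using hpar.refl_left
  | mul a b _ _ ha hb =>
    have := hb.map (α a)
    rw [map_mul]
    exact hX _ _ _ _ _ _ this ha
  | inv a _ ha =>
    have := (ha.map (α a)⁻¹).symm
    simpa using this

/-! ### Isometries translating along a parallelism class preserved by the group -/

/-- If the segments from `x` to `h x` are parallel to all their translates, then so are those from
`x` to `h ^ (2 ^ k) x`, whose length grows linearly in the exponent. -/
theorem NPC3.dist_pow_two_pow (hX : NPC3 X) (hTP : ParallelTransitive X) (α : G →* (X ≃ᵢ X))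
    {x : X} {h : G} (hpar : ∀ g, SegParallel (α g x) (α g (α h x)) x (α h x)) (k : ℕ) :
    dist x (α (h ^ 2 ^ k) x) = 2 ^ k * dist x (α h x) ∧
      ∀ g, SegParallel (α g x) (α g (α (h ^ 2 ^ k) x)) x (α (h ^ 2 ^ k) x) := by
  induction k with
  | zero => simpa using hpar
  | succ k ih =>
    obtain ⟨ihd, ih⟩ := ih
    set n := 2 ^ k with hn
    set q := α (h ^ n) x with hq
    have hr : α (h ^ 2 ^ (k + 1)) x = α (h ^ n) q := by
      rw [pow_succ, mul_two, pow_add, map_mul]; rfl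
    rw [hr]
    set r := α (h ^ n) q with hr'
    have hqr : dist q r = dist x q := (α (h ^ n)).dist_eq x q
    have hxq : SegParallel x q q r := (ih (h ^ n)).symm
    obtain ⟨γ₁, γ₂, hγ₁, hγ₂, -⟩ := id hxq
    obtain ⟨γ, hγ, hrange⟩ := hX x q r hxq γ₁ γ₂ hγ₁ hγ₂
    have hmem : q ∈ range γ := hrange ▸ Or.inl ⟨1, hγ₁.2.1⟩
    obtain ⟨t, ht⟩ := hmem
    have h1 : dist x q = t * dist x r := by
      have := hγ.2.2 0 t
      rw [hγ.1, ht] at this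
      rw [this, Icc.coe_zero, zero_sub, abs_neg, abs_of_nonneg t.2.1]
    have h2 : dist q r = (1 - t) * dist x r := by
      have := hγ.2.2 t 1
      rw [hγ.2.1, ht] at this
      rw [this, Icc.coe_one, abs_sub_comm, abs_of_nonneg (sub_nonneg.2 t.2.2)]
    have hd : dist x r = 2 * dist x q := by linarith
    -- If `x = r`, the parameter `t` of `q` is arbitrary, but `γ` is constant.
    have hhalf : γ unitHalf = q := by
      rw [← dist_eq_zero, ← ht, hγ.2.2]
      have : |(unitHalf : ℝ) - t| * dist x r = |(unitHalf - t) * dist x r| := by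
        rw [abs_mul, abs_of_nonneg (dist_nonneg (x := x) (y := r))]
      rw [this, abs_eq_zero, sub_mul, ← h1, hd]
      simp [unitHalf]
    refine ⟨by rw [hd, ihd, pow_succ]; ring, fun g => ?_⟩
    have e1 := (ih g).dist_eq
    have e2 : SegParallel (α g q) (α g r) q r := by
      have a1 := ih (g * h ^ n)
      rw [map_mul] at a1
      exact hTP _ _ _ _ _ _ a1 (ih (h ^ n)).symm
    refine ⟨α g ∘ γ, γ, hγ.map _, hγ, e1.trans e2.dist_eq, ?_⟩
    rw [Function.comp_apply, hhalf, ← e2.dist_eq]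

/-- The CAT(0) case of the absence of translations.  With `p = h ^ (2 ^ k) x`, the function
`g ↦ quasiInner x (g x) x p` is a homomorphism up to errors bounded independently of `k`; it is
bounded on `M` and `L`, so for every `g`, but grows linearly in `2 ^ k` at `g = h` unless
`h x = x`. -/
theorem IsCAT0.eq_of_segParallel_orbit (hC : IsCAT0 X) (hX : NPC3 X) (hTP : ParallelTransitive X)
    (α : G →* (X ≃ᵢ X)) (hgen : Subgroup.closure ((M : Set G) ∪ (L : Set G)) = ⊤) {x y : X}
    (hx : ∀ g ∈ M, α g x = x) (hy : ∀ g ∈ L, α g y = y) {h : G}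
    (hpar : ∀ g, SegParallel (α g x) (α g (α h x)) x (α h x)) : α h x = x := by
  set p : ℕ → X := fun k => α (h ^ 2 ^ k) x with hp
  have hpow := NPC3.dist_pow_two_pow hX hTP α hpar
  -- Since `d(g p, p) = d(g x, x)`, Cauchy–Schwarz bounds the effect of moving `a`, `b` by `g`.
  have twist : ∀ g a b k, |quasiInner (α g a) (α g b) x (p k) - quasiInner a b x (p k)| ≤
      2 * (dist a b * dist (α g x) x) := by
    intro g a b k
    have e := ((hpow k).2 g).dist_eq
    have e1 := quasiInner_add_right (α g a) (α g b) x (α g x) (p k)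
    have e2 := quasiInner_add_right (α g a) (α g b) (α g x) (α g (p k)) (p k)
    have e3 := quasiInner_map (α g) a b x (p k)
    have e4 := hC.abs_quasiInner_le (α g a) (α g b) x (α g x)
    have e5 := hC.abs_quasiInner_le (α g a) (α g b) (α g (p k)) (p k)
    rw [(α g).dist_eq] at e4 e5
    rw [dist_comm x] at e4
    rw [← e] at e5
    rw [abs_le] at e4 e5 ⊢
    constructor <;> linarith
  have bdd : ∀ g, ∃ B, ∀ k, |quasiInner x (α g x) x (p k)| ≤ B := by
    intro g
    have hg : g ∈ Subgroup.closure ((M : Set G) ∪ (L : Set G)) := hgen ▸ Subgroup.mem_top g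
    induction hg using Subgroup.closure_induction with
    | mem g hg =>
      rcases hg with hg | hg
      · exact ⟨0, fun k => by simp [hx g hg, quasiInner]⟩
      · refine ⟨2 * (dist x y * dist (α g x) x), fun k => ?_⟩
        have e1 := quasiInner_add_left x y (α g x) x (p k)
        have e2 := twist g x y k
        rw [hy g hg, quasiInner_swap_left y (α g x)] at e2
        rw [← e1, ← abs_neg]
        convert e2 using 2
        ring
    | one => exact ⟨0, fun k => by simp [quasiInner]⟩
    | mul a b _ _ ha hb =>
      obtain ⟨A, hA⟩ := ha
      obtain ⟨B, hB⟩ := hb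
      refine ⟨A + B + 2 * (dist x (α b x) * dist (α a x) x), fun k => ?_⟩
      have e1 := quasiInner_add_left x (α a x) (α a (α b x)) x (p k)
      have e2 := twist a x (α b x) k
      have hAk := hA k
      have hBk := hB k
      have e3 : α (a * b) x = α a (α b x) := by rw [map_mul]; rfl
      rw [e3, ← e1]
      rw [abs_le] at *
      constructor <;> linarith
    | inv a _ ha =>
      obtain ⟨A, hA⟩ := ha
      refine ⟨A + 2 * (dist x (α a⁻¹ x) * dist (α a x) x), fun k => ?_⟩
      have e2 := twist a x (α a⁻¹ x) k
      have e3 : α a (α a⁻¹ x) = x := by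
        rw [map_inv]; exact (α a).apply_symm_apply x
      rw [e3, quasiInner_swap_left x (α a x)] at e2
      have hAk := hA k
      rw [abs_le] at *
      constructor <;> linarith
  obtain ⟨B, hB⟩ := bdd h
  set c := dist x (α h x) with hc
  have hle : ∀ m : ℕ, dist x (α (h ^ m) x) ≤ m * c := by
    intro m
    induction m with
    | zero => simp
    | succ m ih =>
      have e1 : α (h ^ (m + 1)) x = α (h ^ m) (α h x) := by rw [pow_succ, map_mul]; rfl
      have e2 := dist_triangle x (α (h ^ m) x) (α (h ^ m) (α h x))
      rw [(α (h ^ m)).dist_eq, ← hc] at e2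
      rw [e1]
      push_cast
      linarith
  have hgrow : ∀ k : ℕ, 2 ^ k * c ^ 2 ≤ B := by
    intro k
    refine le_trans ?_ ((le_abs_self _).trans (hB k))
    obtain ⟨m, hm⟩ : ∃ m, 2 ^ k = m + 1 := Nat.exists_eq_succ_of_ne_zero (by positivity)
    have e1 : dist (α h x) (p k) ≤ m * c := by
      have : p k = α h (α (h ^ m) x) := by
        simp only [hp]
        rw [hm, pow_succ', map_mul]; rfl
      rw [this, (α h).dist_eq]
      exact hle m
    have e2 : dist x (p k) = 2 ^ k * c := (hpow k).1
    have hm' : (2 : ℝ) ^ k = m + 1 := by exact_mod_cast hm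
    have e3 : dist (α h x) (p k) ^ 2 ≤ (m * c) ^ 2 := by gcongr
    have e4 : dist (α h x) x = c := dist_comm _ _
    unfold quasiInner
    rw [e2, e4, hm', dist_self]
    nlinarith
  by_contra hne
  have hc0 : 0 < c := by
    rw [hc, dist_pos]; exact fun h' => hne h'.symm
  obtain ⟨k, hk⟩ := exists_nat_gt (B / c ^ 2)
  rw [div_lt_iff₀ (by positivity)] at hk
  have h2k : (k : ℝ) ≤ 2 ^ k := by exact_mod_cast Nat.lt_two_pow_self.le
  have := mul_le_mul_of_nonneg_right h2k (sq_nonneg c)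
  linarith [hgrow k]

end Parallel

section Banach

variable {E : Type*} [NormedAddCommGroup E] [NormedSpace ℝ E] {G : Type*} [Group G]

/-- The linear part of an isometric action on a real normed space, which is affine by the theorem
of Mazur and Ulam. -/
noncomputable def linearPart (α : G →* (E ≃ᵢ E)) : G →* (E ≃ₗᵢ[ℝ] E) where
  toFun g := (α g).toRealAffineIsometryEquiv.linearIsometryEquiv
  map_one' := by
    ext x
    have := (α 1).toRealAffineIsometryEquiv.map_vsub x 0
    simpa using this
  map_mul' g k := by
    ext x
    have h1 := (α (g * k)).toRealAffineIsometryEquiv.map_vsub x 0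
    have h2 := (α g).toRealAffineIsometryEquiv.map_vsub (α k x) (α k 0)
    have h3 := (α k).toRealAffineIsometryEquiv.map_vsub x 0
    simp only [vsub_eq_sub, sub_zero, IsometryEquiv.coeFn_toRealAffineIsometryEquiv] at h1 h2 h3
    refine h1.trans (Eq.trans ?_ (h2.symm.trans (congrArg _ h3.symm)))
    rw [map_mul]
    rfl

theorem linearPart_sub (α : G →* (E ≃ᵢ E)) (g : G) (a b : E) :
    linearPart α g (a - b) = α g a - α g b := by
  exact (α g).toRealAffineIsometryEquiv.map_vsub a b

/-- The Banach case of the absence of translations: an invariant functional norming the invariant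
vector `h x - x` turns the action into a homomorphism to `ℝ`, which vanishes on `M` and `L`. -/
theorem eq_of_sub_invariant [UniformConvexSpace E] [Group.FG G] {M L : Subgroup G}
    (α : G →* (E ≃ᵢ E)) (hgen : Subgroup.closure ((M : Set G) ∪ (L : Set G)) = ⊤) {x y : E}
    (hx : ∀ g ∈ M, α g x = x) (hy : ∀ g ∈ L, α g y = y) {h : G}
    (hinv : ∀ g, α g (α h x) - α g x = α h x - x) : α h x = x := by
  obtain ⟨f, hfv, hf⟩ := exists_invariant_functional (linearPart α) (v := α h x - x)
    fun g => by rw [linearPart_sub, hinv]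
  have hf' : ∀ g a b, f (α g a - α g b) = f (a - b) := fun g a b => by
    rw [← linearPart_sub, hf]
  have hzero : ∀ g, f (α g x - x) = 0 := by
    intro g
    have hg : g ∈ Subgroup.closure ((M : Set G) ∪ (L : Set G)) := hgen ▸ Subgroup.mem_top g
    induction hg using Subgroup.closure_induction with
    | mem g hg =>
      rcases hg with hg | hg
      · rw [hx g hg, sub_self, map_zero]
      · have e := hf' g x y
        rw [hy g hg, map_sub, map_sub] at e
        rw [map_sub]
        linarith
    | one => simp
    | mul a b _ _ ha hb =>
      have e := hf' a (α b x) x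
      have e3 : α (a * b) x = α a (α b x) := by rw [map_mul]; rfl
      rw [e3]
      rw [map_sub] at *
      linarith [map_sub f (α b x) x]
    | inv a _ ha =>
      have e := hf' a (α a⁻¹ x) x
      have e3 : α a (α a⁻¹ x) = x := by
        rw [map_inv]; exact (α a).apply_symm_apply x
      rw [e3] at e
      rw [← e, ← neg_sub, map_neg, ha, neg_zero]
  rw [hzero h] at hfv
  exact sub_eq_zero.1 (norm_eq_zero.1 hfv.symm)

/-- In a strictly convex space, parallel segments are translates of each other. -/
theorem SegParallel.sub_eq_sub {X : Type*} [MetricSpace X] [StrictConvexSpace ℝ E] (e : X ≃ᵢ E)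
    {x y x' y' : X} (h : SegParallel x y x' y') : e y - e x = e y' - e x' := by
  obtain ⟨γ, γ', h1, h2, h3, h4⟩ := h
  have hm : ∀ {γ : unitInterval → X} {a b : X}, IsGeodesic γ a b →
      e (γ unitHalf) = midpoint ℝ (e a) (e b) := fun h =>
    eq_midpoint_of_dist_eq_half (by simpa only [e.dist_eq] using h.dist_left_half)
      (by simpa only [e.dist_eq] using h.dist_half_right)
  rw [← e.dist_eq, ← e.dist_eq y, dist_eq_norm, dist_eq_norm] at h3
  rw [← e.dist_eq, ← e.dist_eq (γ unitHalf), hm h1, hm h2, dist_eq_norm, dist_eq_norm] at h4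
  have h5 : midpoint ℝ (e x) (e y) - midpoint ℝ (e x') (e y') =
      (1 / 2 : ℝ) • ((e x - e x') + (e y - e y')) := by
    rw [midpoint_eq_smul_add, midpoint_eq_smul_add]
    norm_num
    module
  rw [h5, norm_smul] at h4
  norm_num at h4
  have := eq_of_norm_eq_of_norm_add_eq h3 (by linarith)
  rw [sub_eq_sub_iff_add_eq_add] at this ⊢
  rw [← this, add_comm]

end Banach

/-! ### Ultraproducts of actions -/

section Ultraproduct

variable {𝒳 : Set CMetSpace.{u}}

/-- Stability under ultraproducts, in terms of the quotient map from bounded sequences to a member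
of the class. -/
theorem StableUltraproducts.exists_limit (h : StableUltraproducts 𝒳) :
    ∃ 𝒰 : Ultrafilter ℕ, (𝒰 : Filter ℕ) ≤ atTop ∧
      ∀ (X : ℕ → CMetSpace.{u}) (w : ∀ n, X n), (∀ n, X n ∈ 𝒳) →
        ∃ Y ∈ 𝒳, ∃ q : BoundedSeq 𝒰 X w → Y, Function.Surjective q ∧
          ∀ a b, Tendsto (fun n => dist (a.seq n) (b.seq n)) 𝒰 (𝓝 (dist (q a) (q b))) := by
  obtain ⟨𝒰, h𝒰, H⟩ := h
  refine ⟨𝒰, ?_, fun X w hX => ?_⟩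
  · rw [← Nat.cofinite_eq_atTop]
    exact 𝒰.le_cofinite_or_eq_pure.resolve_right fun ⟨n, hn⟩ => h𝒰 n hn
  · obtain ⟨Y, hY, ⟨e⟩⟩ := H X w hX
    refine ⟨Y, hY, fun a => e (SeparationQuotient.mk a), ?_, fun a b => ?_⟩
    · exact e.surjective.comp SeparationQuotient.surjective_mk
    · rw [e.dist_eq, SeparationQuotient.dist_mk]
      exact a.tendsto_dist b

variable {𝒰 : Ultrafilter ℕ} {X : ℕ → CMetSpace.{u}} {w : ∀ n, X n} {G : Type v} [Group G]

/-- The coordinatewise action on bounded sequences. -/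
def BoundedSeq.act (α : ∀ n, G →* (X n ≃ᵢ X n))
    (hb : ∀ g, ∃ C : ℝ, ∀ n, dist (α n g (w n)) (w n) ≤ C) (g : G) (a : BoundedSeq 𝒰 X w) :
    BoundedSeq 𝒰 X w where
  seq n := α n g (a.seq n)
  bounded := by
    obtain ⟨C, hC⟩ := hb g
    obtain ⟨D, hD⟩ := a.bounded
    refine ⟨D + C, fun n => (dist_triangle _ (α n g (w n)) _).trans ?_⟩
    rw [(α n g).dist_eq]
    exact add_le_add (hD n) (hC n)

/-- Isometric actions that move the base points by a bounded amount induce an isometric action on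
the ultraproduct. -/
theorem exists_limit_action {Y : Type*} [MetricSpace Y] {q : BoundedSeq 𝒰 X w → Y}
    (hq : Function.Surjective q)
    (hdist : ∀ a b, Tendsto (fun n => dist (a.seq n) (b.seq n)) 𝒰 (𝓝 (dist (q a) (q b))))
    (α : ∀ n, G →* (X n ≃ᵢ X n)) (hb : ∀ g, ∃ C : ℝ, ∀ n, dist (α n g (w n)) (w n) ≤ C) :
    ∃ β : G →* (Y ≃ᵢ Y), ∀ g a, β g (q a) = q (a.act α hb g) := by
  have hact : ∀ g a b, dist (q (a.act α hb g)) (q (b.act α hb g)) = dist (q a) (q b) := by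
    intro g a b
    refine tendsto_nhds_unique (hdist _ _) ?_
    simpa only [BoundedSeq.act, IsometryEquiv.dist_eq] using hdist a b
  choose r hr using hq
  let A : G → Y → Y := fun g y => q ((r y).act α hb g)
  have hA : ∀ g a, A g (q a) = q (a.act α hb g) := by
    intro g a
    rw [← dist_eq_zero, hact, hr, dist_self]
  have hAone : ∀ y, A 1 y = y := by
    intro y
    conv_lhs => rw [← hr y]
    rw [hA]
    simp [BoundedSeq.act, hr]
  have hAmul : ∀ g k y, A (g * k) y = A g (A k y) := by
    intro g k y
    change q ((r y).act α hb (g * k)) = A g (q ((r y).act α hb k))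
    rw [hA]
    simp only [BoundedSeq.act, map_mul]
    rfl
  exact ⟨{  toFun := fun g =>
              { toFun := A g
                invFun := A g⁻¹
                left_inv := fun y => by rw [← hAmul, inv_mul_cancel, hAone]
                right_inv := fun y => by rw [← hAmul, mul_inv_cancel, hAone]
                isometry_toFun := Isometry.of_dist_eq fun y z => by
                  change dist (q _) (q _) = _
                  rw [hact, hr, hr] }
            map_one' := IsometryEquiv.ext fun y => hAone y
            map_mul' := fun g k => IsometryEquiv.ext fun y => hAmul g k y }, hA⟩

/-- If generators move the base points by a bounded amount, so does every group element. -/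
theorem exists_dist_le_of_closure {T : Set G} (hT : Subgroup.closure T = ⊤)
    (α : ∀ n, G →* (X n ≃ᵢ X n)) (h : ∀ g ∈ T, ∃ C : ℝ, ∀ n, dist (α n g (w n)) (w n) ≤ C)
    (g : G) : ∃ C : ℝ, ∀ n, dist (α n g (w n)) (w n) ≤ C := by
  have hg : g ∈ Subgroup.closure T := hT ▸ Subgroup.mem_top g
  induction hg using Subgroup.closure_induction with
  | mem g hg => exact h g hg
  | one => exact ⟨0, fun n => by simp⟩
  | mul a b _ _ ha hb =>
    obtain ⟨A, hA⟩ := ha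
    obtain ⟨B, hB⟩ := hb
    refine ⟨B + A, fun n => ?_⟩
    have e : α n (a * b) (w n) = α n a (α n b (w n)) := by rw [map_mul]; rfl
    rw [e]
    refine (dist_triangle _ (α n a (w n)) _).trans ?_
    rw [(α n a).dist_eq]
    exact add_le_add (hB n) (hA n)
  | inv a _ ha =>
    obtain ⟨A, hA⟩ := ha
    refine ⟨A, fun n => ?_⟩
    have e : α n a (α n a⁻¹ (w n)) = w n := by
      rw [map_inv]; exact (α n a).apply_symm_apply _
    rw [← (α n a).dist_eq, e, dist_comm]
    exact hA n

/-- A Banach space all of whose ultrapowers satisfy `(NPC2)` is uniformly convex: a failure of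
uniform convexity yields, in an ultrapower, distinct points `a`, `b` of the unit sphere with
midpoint on the unit sphere. -/
theorem uniformConvexSpace_of_stableUltraproducts (hU : StableUltraproducts 𝒳)
    (hN : ∀ X ∈ 𝒳, NPC2 X) {X : CMetSpace.{u}} (hX : X ∈ 𝒳) {E : Type*} [NormedAddCommGroup E]
    [NormedSpace ℝ E] (e : X ≃ᵢ E) : UniformConvexSpace E := by
  refine ⟨fun ε hε => ?_⟩
  by_contra! hcon
  have hδ : ∀ n : ℕ, (0 : ℝ) < 1 / ((n : ℝ) + 1) := fun n => by positivity
  choose a ha b hb hab hsum using fun n : ℕ => hcon (1 / ((n : ℝ) + 1)) (hδ n)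
  obtain ⟨𝒰, h𝒰, H⟩ := hU.exists_limit
  obtain ⟨Y, hY, q, -, hq⟩ := H (fun _ => X) (fun _ => e.symm 0) fun _ => hX
  have hbdd : ∀ s : unitInterval, ∀ n, ‖AffineMap.lineMap (a n) (b n) (s : ℝ)‖ ≤ 1 := by
    intro s n
    rw [AffineMap.lineMap_apply_module]
    refine (norm_add_le _ _).trans ?_
    rw [norm_smul, norm_smul, ha, hb, Real.norm_of_nonneg s.2.1,
      Real.norm_of_nonneg (sub_nonneg.2 s.2.2)]
    linarith
  let seg : unitInterval → BoundedSeq 𝒰 (fun _ => X) (fun _ => e.symm 0) := fun s =>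
    ⟨fun n => e.symm (AffineMap.lineMap (a n) (b n) (s : ℝ)), 1, fun n => by
      rw [e.symm.dist_eq, dist_zero_right]
      exact hbdd s n⟩
  let o : BoundedSeq 𝒰 (fun _ => X) (fun _ => e.symm 0) :=
    ⟨fun _ => e.symm 0, 0, fun n => by simp⟩
  have hseg : ∀ s t : unitInterval, Tendsto (fun n => |(s : ℝ) - t| * dist (a n) (b n)) 𝒰
      (𝓝 (dist (q (seg s)) (q (seg t)))) := by
    intro s t
    have := hq (seg s) (seg t)
    simpa only [seg, e.symm.dist_eq, dist_lineMap_lineMap, Real.dist_eq] using this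
  have ho : ∀ s : unitInterval, Tendsto (fun n => ‖AffineMap.lineMap (a n) (b n) (s : ℝ)‖) 𝒰
      (𝓝 (dist (q o) (q (seg s)))) := by
    intro s
    have := hq o (seg s)
    simpa only [seg, o, e.symm.dist_eq, dist_zero_left] using this
  have h01 : Tendsto (fun n => dist (a n) (b n)) 𝒰 (𝓝 (dist (q (seg 0)) (q (seg 1)))) := by
    simpa using hseg 0 1
  have hgeo : IsGeodesic (fun s => q (seg s)) (q (seg 0)) (q (seg 1)) :=
    ⟨rfl, rfl, fun s t => tendsto_nhds_unique (hseg s t) (h01.const_mul _)⟩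
  have e0 : dist (q o) (q (seg 0)) = 1 :=
    tendsto_nhds_unique (ho 0) (by simp [ha])
  have e1 : dist (q o) (q (seg 1)) = 1 :=
    tendsto_nhds_unique (ho 1) (by simp [hb])
  have eh : dist (q o) (q (seg unitHalf)) = 1 := by
    refine tendsto_nhds_unique (ho unitHalf) ?_
    have hlow : ∀ n : ℕ, 1 - 1 / ((n : ℝ) + 1) ≤
        ‖AffineMap.lineMap (a n) (b n) (unitHalf : ℝ)‖ := by
      intro n
      have : AffineMap.lineMap (a n) (b n) (unitHalf : ℝ) = (1 / 2 : ℝ) • (a n + b n) := by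
        rw [AffineMap.lineMap_apply_module]
        simp only [unitHalf]
        module
      rw [this, norm_smul]
      norm_num
      have := hsum n
      have := hδ n
      rw [one_div] at *
      linarith
    refine tendsto_of_tendsto_of_tendsto_of_le_of_le ?_ tendsto_const_nhds hlow
      (hbdd unitHalf)
    have := (tendsto_one_div_add_atTop_nhds_zero_nat (𝕜 := ℝ)).mono_left h𝒰
    simpa using this.const_sub 1
  have heq : q (seg 0) = q (seg 1) :=
    (hN Y hY).eq_of_dist_half_eq hgeo (e0.trans e1.symm) (e1.trans eh.symm)
  rw [heq, dist_self] at h01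
  have : ε ≤ 0 := ge_of_tendsto' h01 fun n => by
    rw [dist_eq_norm]; exact hab n
  linarith

end Ultraproduct

/-! ### Displacement and uniform actions -/

section Displacement

variable {G : Type v} [Group G]

/-- The action obtained from `α` by transport along a similarity of ratio `r`. -/
def conjugateAction {X Y : Type*} [MetricSpace X] [MetricSpace Y] (α : G →* (X ≃ᵢ X)) (f : X ≃ Y)
    (r : ℝ) (hf : ∀ a b, dist (f a) (f b) = r * dist a b) : G →* (Y ≃ᵢ Y) where
  toFun g :=
    { toFun := fun y => f (α g (f.symm y))
      invFun := fun y => f (α g⁻¹ (f.symm y))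
      left_inv := fun y => by simp
      right_inv := fun y => by simp
      isometry_toFun := Isometry.of_dist_eq fun y z => by
        rw [hf, (α g).dist_eq, ← hf, f.apply_symm_apply, f.apply_symm_apply] }
  map_one' := IsometryEquiv.ext fun y => by
    change f (α 1 (f.symm y)) = y
    simp
  map_mul' g k := IsometryEquiv.ext fun y => by
    change f (α (g * k) (f.symm y)) = f (α g (f.symm (f (α k (f.symm y)))))
    rw [map_mul, f.symm_apply_apply]
    rfl

theorem conjugateAction_apply {X Y : Type*} [MetricSpace X] [MetricSpace Y] (α : G →* (X ≃ᵢ X))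
    (f : X ≃ Y) (r : ℝ) (hf : ∀ a b, dist (f a) (f b) = r * dist a b) (g : G) (x : X) :
    conjugateAction α f r hf g (f x) = f (α g x) := by
  change f (α g (f.symm (f x))) = _
  rw [f.symm_apply_apply]

variable {X : Type*} [MetricSpace X]

/-- The subgroup of the elements of `G` that fix the point `x`. -/
def pointFixer (α : G →* (X ≃ᵢ X)) (x : X) : Subgroup G where
  carrier := {g | α g x = x}
  one_mem' := by simp
  mul_mem' {a b} ha hb := by
    change α (a * b) x = x
    rw [map_mul, IsometryEquiv.mul_apply, hb, ha]
  inv_mem' {a} ha := by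
    change α a⁻¹ x = x
    conv_lhs => rw [← show α a x = x from ha]
    rw [map_inv, IsometryEquiv.inv_apply_self]

theorem mem_pointFixer {α : G →* (X ≃ᵢ X)} {x : X} {g : G} :
    g ∈ pointFixer α x ↔ α g x = x := Iff.rfl

/-- The total displacement of the point `x` by the elements of `S`. -/
noncomputable def displacement (S : Finset G) (α : G →* (X ≃ᵢ X)) (x : X) : ℝ :=
  ∑ s ∈ S, dist (α s x) x

theorem displacement_nonneg (S : Finset G) (α : G →* (X ≃ᵢ X)) (x : X) :
    0 ≤ displacement S α x :=
  Finset.sum_nonneg fun _ _ => dist_nonneg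

theorem continuous_displacement (S : Finset G) (α : G →* (X ≃ᵢ X)) :
    Continuous (displacement S α) :=
  continuous_finsetSum _ fun s _ => (α s).continuous.dist continuous_id

theorem pointFixer_eq_top {S : Finset G} (hS : Subgroup.closure (S : Set G) = ⊤)
    {α : G →* (X ≃ᵢ X)} {x : X} (h : displacement S α x = 0) : pointFixer α x = ⊤ := by
  rw [eq_top_iff, ← hS, Subgroup.closure_le]
  intro s hs
  exact dist_eq_zero.1 ((Finset.sum_eq_zero_iff_of_nonneg fun _ _ => dist_nonneg).1 h s hs)

/-- An action is uniform if it displaces all points by at least `1 / 2`. -/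
def IsUniformAction (S : Finset G) (α : G →* (X ≃ᵢ X)) : Prop :=
  ∀ x, 1 / 2 ≤ displacement S α x

theorem IsUniformAction.pointFixer_ne_top {S : Finset G} {α : G →* (X ≃ᵢ X)}
    (h : IsUniformAction S α) (x : X) : pointFixer α x ≠ ⊤ := by
  intro hx
  have h0 : displacement S α x = 0 := Finset.sum_eq_zero fun s _ => by
    rw [mem_pointFixer.1 (hx ▸ Subgroup.mem_top s), dist_self]
  have := h x
  rw [h0] at this
  norm_num at this

/-- Uniformity with respect to a `Π`-invariant set is inherited by twists of the action by elements
of `Inn(G) · Π`. -/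
theorem IsUniformAction.comp {S : Finset G} {α : G →* (X ≃ᵢ X)} (h : IsUniformAction S α)
    {π : MulAut G} (hπ : ∀ s, π s ∈ S ↔ s ∈ S) (g : G) :
    IsUniformAction S (α.comp (MulAut.conj g * π).toMonoidHom) := by
  intro x
  refine (h (α g⁻¹ x)).trans (le_of_eq ?_)
  refine (Finset.sum_equiv π.toEquiv (fun s => (hπ s).symm) fun s _ => ?_).symm
  have e : α g (α g⁻¹ x) = x := by
    rw [map_inv]; exact IsometryEquiv.apply_inv_self _ _
  have e' : α.comp (MulAut.conj g * π).toMonoidHom s x = α g (α (π s) (α g⁻¹ x)) := by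
    change α (g * π s * g⁻¹) x = _
    rw [map_mul, map_mul]
    rfl
  rw [e']
  conv_lhs => rw [← e]
  rw [(α g).dist_eq, e]
  rfl

theorem exists_finset_generating [Group.FG G] {Pi : Subgroup (MulAut G)}
    (hPi : (Pi : Set (MulAut G)).Finite) :
    ∃ S : Finset G, Subgroup.closure (S : Set G) = ⊤ ∧ ∀ π ∈ Pi, ∀ s, π s ∈ S ↔ s ∈ S := by
  classical
  obtain ⟨S₀, hS₀⟩ := Group.FG.out (G := G)
  have key : ∀ π ∈ Pi, ∀ s, s ∈ hPi.toFinset.biUnion (fun π => S₀.image π) →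
      π s ∈ hPi.toFinset.biUnion (fun π => S₀.image π) := by
    intro π hπ s hs
    simp only [Finset.mem_biUnion, Finset.mem_image, Finite.mem_toFinset, SetLike.mem_coe] at hs ⊢
    obtain ⟨τ, hτ, t, ht, rfl⟩ := hs
    exact ⟨π * τ, Pi.mul_mem hπ hτ, t, ht, rfl⟩
  refine ⟨hPi.toFinset.biUnion fun π => S₀.image π, ?_, fun π hπ s => ⟨fun h => ?_, key π hπ s⟩⟩
  · rw [eq_top_iff, ← hS₀]
    refine Subgroup.closure_mono fun s hs => ?_
    simp only [Finset.coe_biUnion, mem_iUnion, Finset.coe_image]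
    exact ⟨1, by simp [Pi.one_mem], s, hs, rfl⟩
  · simpa using key π⁻¹ (Pi.inv_mem hπ) _ h

/-- A positive continuous function on a complete space has points at which it is, up to a factor
`2`, minimal on a ball of radius `R` times its value: otherwise, successively halving the function
would lead to a zero. -/
theorem exists_half_le_on_ball [CompleteSpace X] {F : X → ℝ} (hF : Continuous F)
    (hF0 : ∀ x, 0 < F x) (z : X) (R : ℝ) :
    ∃ x, F x ≤ F z ∧ ∀ y, dist x y ≤ R * F x → F x / 2 ≤ F y := by
  by_contra! hcon
  choose next hd hn using hcon
  let step : {x // F x ≤ F z} → {x // F x ≤ F z} := fun p =>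
    ⟨next p.1 p.2, by linarith [hn p.1 p.2, hF0 p.1, p.2]⟩
  let x : ℕ → {x // F x ≤ F z} := fun n => step^[n] ⟨z, le_rfl⟩
  have hx : ∀ n, x (n + 1) = step (x n) := fun n => Function.iterate_succ_apply' _ _ _
  have hFx : ∀ n, F (x n) ≤ F z * (1 / 2) ^ n := by
    intro n
    induction n with
    | zero => simp [x]
    | succ n ih =>
      have := hn (x n).1 (x n).2
      rw [hx, pow_succ]
      change F (next (x n).1 (x n).2) ≤ _
      linarith
  have hdx : ∀ n, dist (x n).1 (x (n + 1)).1 ≤ |R| * F z * (1 / 2) ^ n := by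
    intro n
    rw [hx]
    refine (hd (x n).1 (x n).2).trans ?_
    rw [mul_assoc]
    exact (mul_le_mul_of_nonneg_right (le_abs_self R) (hF0 _).le).trans
      (mul_le_mul_of_nonneg_left (hFx n) (abs_nonneg R))
  obtain ⟨p, hp⟩ := cauchySeq_tendsto_of_complete
    (cauchySeq_of_le_geometric (1 / 2) _ (by norm_num) hdx)
  have h1 : Tendsto (fun n => F (x n).1) atTop (𝓝 (F p)) := (hF.tendsto p).comp hp
  have h2 : Tendsto (fun n : ℕ => F z * (1 / 2 : ℝ) ^ n) atTop (𝓝 0) := by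
    simpa using (tendsto_pow_atTop_nhds_zero_of_lt_one (r := (1 / 2 : ℝ)) (by norm_num)
      (by norm_num)).const_mul (F z)
  exact (hF0 p).not_ge (le_of_tendsto_of_tendsto' h1 h2 hFx)

end Displacement

section LimitActions

variable {𝒳 : Set CMetSpace.{u}} {G : Type v} [Group G]

theorem tendsto_displacement {𝒰 : Ultrafilter ℕ} {X : ℕ → CMetSpace.{u}} {w : ∀ n, X n}
    {Y : Type*} [MetricSpace Y] {q : BoundedSeq 𝒰 X w → Y}
    (hdist : ∀ a b, Tendsto (fun n => dist (a.seq n) (b.seq n)) 𝒰 (𝓝 (dist (q a) (q b))))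
    {α : ∀ n, G →* (X n ≃ᵢ X n)} {hb : ∀ g, ∃ C : ℝ, ∀ n, dist (α n g (w n)) (w n) ≤ C}
    {β : G →* (Y ≃ᵢ Y)} (hβ : ∀ g a, β g (q a) = q (a.act α hb g)) (S : Finset G)
    (a : BoundedSeq 𝒰 X w) :
    Tendsto (fun n => displacement S (α n) (a.seq n)) 𝒰 (𝓝 (displacement S β (q a))) := by
  refine tendsto_finsetSum _ fun s _ => ?_
  rw [hβ]
  exact hdist (a.act α hb s) a

/-- If some action on a member of `𝒳` has no fixed point, some action on a member of `𝒳` is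
uniform.  Such an action arises as an ultraproduct of rescalings around points of almost minimal
displacement. -/
theorem exists_isUniformAction (hScale : StableScalingUp 𝒳) (hU : StableUltraproducts 𝒳)
    {S : Finset G} (hS : Subgroup.closure (S : Set G) = ⊤) {X : CMetSpace.{u}} (hX : X ∈ 𝒳)
    (α : G →* (X ≃ᵢ X)) (hα : ∀ x, pointFixer α x ≠ ⊤) :
    ∃ Y ∈ 𝒳, ∃ β : G →* (Y ≃ᵢ Y), IsUniformAction S β := by
  by_cases hall : IsUniformAction S α
  · exact ⟨X, hX, α, hall⟩
  unfold IsUniformAction at hall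
  push Not at hall
  obtain ⟨z, hz⟩ := hall
  have hpos : ∀ x, 0 < displacement S α x := fun x =>
    (displacement_nonneg S α x).lt_of_ne fun h => hα x (pointFixer_eq_top hS h.symm)
  choose x hxz hx using fun n : ℕ =>
    exists_half_le_on_ball (continuous_displacement S α) hpos z (n : ℝ)
  set r : ℕ → ℝ := fun n => (displacement S α (x n))⁻¹ with hr
  have hr0 : ∀ n, 0 < r n := fun n => inv_pos.2 (hpos _)
  have hr1 : ∀ n, 1 ≤ r n := fun n => (one_le_inv₀ (hpos _)).2 (by linarith [hxz n])
  choose Y hY f hf using fun n => hScale X hX (r n) (hr1 n)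
  let β : ∀ n, G →* (Y n ≃ᵢ Y n) := fun n => conjugateAction α (f n) (r n) (hf n)
  have hβ : ∀ n p, displacement S (β n) (f n p) = r n * displacement S α p := by
    intro n p
    unfold displacement
    rw [Finset.mul_sum]
    refine Finset.sum_congr rfl fun s _ => ?_
    rw [conjugateAction_apply, hf]
  have hb : ∀ g, ∃ C : ℝ, ∀ n, dist (β n g (f n (x n))) (f n (x n)) ≤ C := by
    refine exists_dist_le_of_closure hS β fun s hs => ⟨1, fun n => ?_⟩
    have h1 : dist (β n s (f n (x n))) (f n (x n)) ≤ displacement S (β n) (f n (x n)) :=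
      Finset.single_le_sum (f := fun s => dist (β n s (f n (x n))) (f n (x n)))
        (fun _ _ => dist_nonneg) hs
    rwa [hβ, hr, inv_mul_cancel₀ (hpos _).ne'] at h1
  obtain ⟨𝒰, h𝒰, H⟩ := hU.exists_limit
  obtain ⟨Z, hZ, q, hq, hdist⟩ := H Y (fun n => f n (x n)) hY
  obtain ⟨γ, hγ⟩ := exists_limit_action hq hdist β hb
  refine ⟨Z, hZ, γ, fun p => ?_⟩
  obtain ⟨a, rfl⟩ := hq p
  refine ge_of_tendsto (tendsto_displacement hdist hγ S a) ?_
  -- A bounded sequence stays in the balls of radius `n`, where the displacement is at least `1 / 2`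
  -- after rescaling.
  obtain ⟨C, hC⟩ := a.bounded
  filter_upwards [h𝒰 (eventually_ge_atTop ⌈C⌉₊)] with n hn
  obtain ⟨p, hp⟩ := (f n).surjective (a.seq n)
  have h1 := hC n
  rw [← hp, hf, dist_comm] at h1
  have h2 : C ≤ n := (Nat.le_ceil C).trans (by exact_mod_cast hn)
  have h3 : dist (x n) p ≤ n * displacement S α (x n) := by
    have h4 := h1.trans h2
    rw [hr, inv_mul_le_iff₀ (hpos _)] at h4
    linarith
  have h5 := mul_le_mul_of_nonneg_left (hx n p h3) (hr0 n).le
  rw [← hp, hβ]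
  refine le_trans (le_of_eq ?_) h5
  have := (hpos (x n)).ne'
  simp only [hr]
  field_simp

/-- The distances between an `M`-fixed and an `L`-fixed point for uniform actions on members of the
class `𝒳`. -/
def uniformDistances (𝒳 : Set CMetSpace.{u}) (S : Finset G) (M L : Subgroup G) : Set ℝ :=
  {d | ∃ X ∈ 𝒳, ∃ α : G →* (X ≃ᵢ X), IsUniformAction S α ∧
    ∃ x y : X, M ≤ pointFixer α x ∧ L ≤ pointFixer α y ∧ dist x y = d}

/-- The infimum of the distances between `M`-fixed and `L`-fixed points for uniform actions is
attained, in an ultraproduct of actions which almost attain it. -/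
theorem exists_isLeast_uniformDistances (hU : StableUltraproducts 𝒳) (S : Finset G)
    {M L : Subgroup G} (hgen : Subgroup.closure ((M : Set G) ∪ (L : Set G)) = ⊤)
    (hne : (uniformDistances 𝒳 S M L).Nonempty) :
    ∃ D, IsLeast (uniformDistances 𝒳 S M L) D := by
  have hbelow : BddBelow (uniformDistances 𝒳 S M L) := by
    refine ⟨0, ?_⟩
    rintro _ ⟨X, -, α, -, x, y, -, -, rfl⟩
    exact dist_nonneg
  refine ⟨sInf (uniformDistances 𝒳 S M L), ?_, fun d hd => csInf_le hbelow hd⟩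
  obtain ⟨u, -, hu, huD⟩ := exists_seq_tendsto_sInf hne hbelow
  choose X hX α hα x y hx hy hd using huD
  obtain ⟨C, hC⟩ := hu.bddAbove_range
  have hdC : ∀ n, dist (x n) (y n) ≤ C := fun n => (hd n).trans_le (hC ⟨n, rfl⟩)
  have hb : ∀ g, ∃ C : ℝ, ∀ n, dist (α n g (x n)) (x n) ≤ C := by
    refine exists_dist_le_of_closure hgen α fun g hg => ?_
    rcases hg with hg | hg
    · exact ⟨0, fun n => by rw [mem_pointFixer.1 (hx n hg), dist_self]⟩
    · refine ⟨C + C, fun n => (dist_triangle _ (α n g (y n)) _).trans ?_⟩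
      rw [(α n g).dist_eq, mem_pointFixer.1 (hy n hg), dist_comm (y n)]
      exact add_le_add (hdC n) (hdC n)
  obtain ⟨𝒰, h𝒰, H⟩ := hU.exists_limit
  obtain ⟨Z, hZ, q, hq, hdist⟩ := H X x hX
  obtain ⟨γ, hγ⟩ := exists_limit_action hq hdist α hb
  let a : BoundedSeq 𝒰 X x := ⟨x, 0, fun n => by simp⟩
  let b : BoundedSeq 𝒰 X x := ⟨y, C, fun n => by rw [dist_comm]; exact hdC n⟩
  refine ⟨Z, hZ, γ, fun p => ?_, q a, q b, fun g hg => ?_, fun g hg => ?_, ?_⟩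
  · obtain ⟨c, rfl⟩ := hq p
    exact ge_of_tendsto' (tendsto_displacement hdist hγ S c) fun n => hα n _
  · rw [mem_pointFixer, hγ]
    congr 1
    simp only [a, BoundedSeq.act, BoundedSeq.mk.injEq]
    exact funext fun n => hx n hg
  · rw [mem_pointFixer, hγ]
    congr 1
    simp only [b, BoundedSeq.act, BoundedSeq.mk.injEq]
    exact funext fun n => hy n hg
  · refine tendsto_nhds_unique (hdist a b) ?_
    simp only [a, b, hd]
    exact hu.mono_left h𝒰

end LimitActions

/-! ### Playing the game -/

section Game

variable {𝒳 : Set CMetSpace.{u}} {G : Type v} [Group G]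

/-- Absence of translations: if `h` moves an `M`-fixed point `x` and an `L`-fixed point `y` in
parallel, to points fixed by `M` and `L` again, then `h` fixes `x`. -/
theorem SixAssumptions.eq_of_segParallel [Group.FG G] (h𝒳 : SixAssumptions 𝒳)
    (hBC : (∀ X ∈ 𝒳, IsBanachSpace X) ∨ (∀ X ∈ 𝒳, IsCAT0 X)) {X : CMetSpace.{u}} (hX : X ∈ 𝒳)
    {M L : Subgroup G} (hgen : Subgroup.closure ((M : Set G) ∪ (L : Set G)) = ⊤)
    (α : G →* (X ≃ᵢ X)) {x y : X} {h : G} (hx : M ≤ pointFixer α x)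
    (hx' : M ≤ pointFixer α (α h x)) (hy : L ≤ pointFixer α y)
    (hy' : L ≤ pointFixer α (α h y)) (hpar : SegParallel x (α h x) y (α h y)) :
    α h x = x := by
  have horb := (h𝒳.tp X hX).segParallel_orbit α hgen hx hx' hy hy' hpar
  rcases hBC with hB | hC
  · obtain ⟨E, _, _, -, ⟨e⟩⟩ := hB X hX
    have : UniformConvexSpace E :=
      uniformConvexSpace_of_stableUltraproducts h𝒳.ultraproducts h𝒳.npc2 hX e
    have he : ∀ a b, dist (e.toEquiv a) (e.toEquiv b) = 1 * dist a b := fun a b =>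
      (e.dist_eq a b).trans (one_mul _).symm
    have hconj : ∀ g p, conjugateAction α e.toEquiv 1 he g (e p) = e (α g p) :=
      conjugateAction_apply α e.toEquiv 1 he
    have := eq_of_sub_invariant (conjugateAction α e.toEquiv 1 he) hgen (x := e x) (y := e y)
      (h := h) (fun g hg => by rw [hconj, mem_pointFixer.1 (hx hg)])
      (fun g hg => by rw [hconj, mem_pointFixer.1 (hy hg)]) fun g => by
        rw [hconj, hconj, hconj]
        exact (horb g).sub_eq_sub e
    rw [hconj] at this
    exact e.injective this
  · exact (hC X hX).eq_of_segParallel_orbit (h𝒳.npc3 X hX) (h𝒳.tp X hX) α hgen hx hy horb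

theorem NPC1.map_half_eq {X : Type u} [MetricSpace X] (hX : NPC1 X) {γ : unitInterval → X} {x y : X}
    (hγ : IsGeodesic γ x y) (α : G →* (X ≃ᵢ X)) {g : G} (hx : g ∈ pointFixer α x)
    (hy : g ∈ pointFixer α y) : g ∈ pointFixer α (γ unitHalf) := by
  have h := hγ.map (α g)
  rw [mem_pointFixer.1 hx, mem_pointFixer.1 hy] at h
  exact congrFun ((hX.1 x y).unique h hγ) unitHalf

theorem dist_perm_fin_two {X : Type*} [MetricSpace X] (x : Fin 2 → X) (σ : Equiv.Perm (Fin 2)) :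
    dist (x (σ 0)) (x (σ 1)) = dist (x 0) (x 1) := by
  have : σ 0 = 0 ∧ σ 1 = 1 ∨ σ 0 = 1 ∧ σ 1 = 0 := by
    revert σ; decide
  rcases this with ⟨h0, h1⟩ | ⟨h0, h1⟩
  · rw [h0, h1]
  · rw [h0, h1, dist_comm]

/-- The invariant of the game: at every position `H`, for every uniform action, each pair
`(x 0, x 1)` of fixed points of `M` and `L` at the minimal distance `D` is fixed by
`(H 0, H 1)`.  Moves of type `(II_σ)` preserve it since the twisted actions are uniform as well;
for moves of type `(I⁺)`, the pair and its translate by `h` are joined by parallel segments. -/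
theorem SixAssumptions.le_pointFixer_of_reachable [Group.FG G] (h𝒳 : SixAssumptions 𝒳)
    (hBC : (∀ X ∈ 𝒳, IsBanachSpace X) ∨ (∀ X ∈ 𝒳, IsCAT0 X)) {M L : Subgroup G}
    {Pi : Subgroup (MulAut G)} (hgen : Subgroup.closure ((M : Set G) ∪ (L : Set G)) = ⊤)
    {S : Finset G} (hSPi : ∀ π ∈ Pi, ∀ s, π s ∈ S ↔ s ∈ S) {D : ℝ}
    (hD : D ∈ lowerBounds (uniformDistances 𝒳 S M L)) {H : Fin 2 → Subgroup G}
    (hH : Relation.ReflTransGen (GamePlusMove ![M, L] Pi) ![M, L] H) :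
    ∀ X ∈ 𝒳, ∀ α : G →* (X ≃ᵢ X), IsUniformAction S α → ∀ x : Fin 2 → X,
      (∀ i, ![M, L] i ≤ pointFixer α (x i)) → dist (x 0) (x 1) = D →
        ∀ i, H i ≤ pointFixer α (x i) := by
  induction hH with
  | refl => exact fun X _ α _ x hx _ => hx
  | tail _ hmove ih =>
    intro X hX α hα x hx hxD
    cases hmove with
    | typeI P hP =>
      have hHx := ih X hX α hα x hx hxD
      suffices hfix : ∀ h ∈ P, ∀ i, h ∈ pointFixer α (x i) from fun i =>
        sup_le (hHx i) ((Subgroup.closure_le _).2 fun h hh => hfix h hh i)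
      intro h hh
      have hx' : ∀ i, ![M, L] i ≤ pointFixer α (α h (x i)) := by
        intro i
        refine (hP h hh i).trans (Subgroup.map_le_iff_le_comap.2 fun k hk => ?_)
        change α (h * k * h⁻¹) (α h (x i)) = α h (x i)
        rw [map_mul, map_mul, map_inv, IsometryEquiv.mul_apply, IsometryEquiv.mul_apply,
          IsometryEquiv.inv_apply_self, mem_pointFixer.1 (hHx i hk)]
      have hnpc := h𝒳.npc1 X hX
      choose γ hγ using fun i => (hnpc.1 (x i) (α h (x i))).exists
      have hdist : dist (x 0) (x 1) = dist (α h (x 0)) (α h (x 1)) := ((α h).dist_eq _ _).symm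
      have hle := hnpc.2 _ _ _ _ _ _ (hγ 0) (hγ 1) hdist unitHalf
      have hge : D ≤ dist (γ 0 unitHalf) (γ 1 unitHalf) :=
        hD ⟨X, hX, α, hα, _, _, fun g hg => hnpc.map_half_eq (hγ 0) α (hx 0 hg) (hx' 0 hg),
          fun g hg => hnpc.map_half_eq (hγ 1) α (hx 1 hg) (hx' 1 hg), rfl⟩
      have hpar : SegParallel (x 0) (α h (x 0)) (x 1) (α h (x 1)) :=
        ⟨γ 0, γ 1, hγ 0, hγ 1, hdist, by rw [← hdist]; linarith⟩
      have h0 : α h (x 0) = x 0 :=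
        h𝒳.eq_of_segParallel hBC hX hgen α (hx 0) (hx' 0) (hx 1) (hx' 1) hpar
      have h1 : α h (x 1) = x 1 :=
        h𝒳.eq_of_segParallel hBC hX (by rwa [union_comm]) α (hx 1) (hx' 1) (hx 0) (hx' 0)
          hpar.symm
      exact Fin.forall_fin_two.2 ⟨h0, h1⟩
    | typeII σ Λ hΛ hσ =>
      have hHx := ih X hX α hα x hx hxD
      refine fun i => sup_le (hHx i) (iSup₂_le fun φ hφ => ?_)
      obtain ⟨g, π, hπ, rfl⟩ := hΛ φ hφ
      -- The same two points, in the order given by `σ`, are a minimal pair for the twisted action.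
      have hy := ih X hX _ (hα.comp (hSPi π hπ) g) (fun j => x (σ⁻¹ j))
        (fun j => Subgroup.map_le_iff_le_comap.1 ((hσ _ hφ j).trans (hHx (σ⁻¹ j))))
        ((dist_perm_fin_two x σ⁻¹).trans hxD) (σ i)
      rw [show σ⁻¹ (σ i) = i from σ.symm_apply_apply i] at hy
      exact Subgroup.map_le_iff_le_comap.2 hy

end Game

theorem mainTheorem2 (𝒳 : Set CMetSpace.{u}) (h𝒳 : SixAssumptions 𝒳)
    (hBC : (∀ X ∈ 𝒳, IsBanachSpace X) ∨ (∀ X ∈ 𝒳, IsCAT0 X))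
    {G : Type v} [Group G] [Group.FG G] (M L : Subgroup G) (Pi : Subgroup (MulAut G))
    (hgen : Subgroup.closure ((M : Set G) ∪ (L : Set G)) = ⊤)
    (hPi : (Pi : Set (MulAut G)).Finite)
    (hgame : GamePlusWinnable M L Pi)
    (hM : RelativePropertyF 𝒳 M) (hL : RelativePropertyF 𝒳 L) :
    PropertyF 𝒳 G := by
  intro X hX α
  by_contra hcon
  have hα : ∀ x, pointFixer α x ≠ ⊤ := fun x hx =>
    hcon ⟨x, fun g _ => mem_pointFixer.1 (hx ▸ Subgroup.mem_top g)⟩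
  obtain ⟨S, hS, hSPi⟩ := exists_finset_generating hPi
  obtain ⟨Y, hY, β, hβ⟩ :=
    exists_isUniformAction h𝒳.scaling h𝒳.ultraproducts hS hX α hα
  obtain ⟨y, hy⟩ := hM Y hY β
  obtain ⟨z, hz⟩ := hL Y hY β
  obtain ⟨D, ⟨Z, hZ, γ, hγ, p, q, hp, hq, hpq⟩, hD⟩ :=
    exists_isLeast_uniformDistances h𝒳.ultraproducts S hgen
      ⟨dist y z, Y, hY, β, hβ, y, z, hy, hz, rfl⟩
  obtain ⟨H, hH, hwin⟩ := hgame
  have hfix := h𝒳.le_pointFixer_of_reachable hBC hgen hSPi hD hH Z hZ γ hγ ![p, q]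
    (Fin.forall_fin_two.2 ⟨hp, hq⟩) hpq
  rcases hwin with h | h
  · exact hγ.pointFixer_ne_top _ (top_le_iff.1 (h ▸ hfix 0))
  · exact hγ.pointFixer_ne_top _ (top_le_iff.1 (h ▸ hfix 1))
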